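/- Let $d\ge 1$, and let all functions and distributions on $\mathbb{R}^d$ be complex valued. Fix a smooth radial function $\chi:\mathbb{R}^d\to\mathbb{R}$, supported in the ball $\{|\xi|\le 2\}$, equal to $1$ in a neighbourhood of $\{|\xi|\le 1\}$, and such that $t\mapsto\chi(te)$ is nonincreasing on $[0,\infty)$ for every unit vector $e$. Set $\varphi(\xi)=\chi(\xi)-\chi(2\xi)$ and, for $m\in\mathbb{Z}$ and a tempered distribution $f\in\mathcal{S}'(\mathbb{R}^d)$, let $\dot\Delta_m f=\mathcal{F}^{-1}\big[\varphi(2^{-m}\xi)\widehat f(\xi)\big]$. Each $\dot\Delta_m$ annihilates the space $\mathcal{P}$ of polynomials, so it is defined on $\mathcal{S}'/\mathcal{P}$. For $s\in\mathbb{R}$ and $p,r\in[1,+\infty]$, the homogeneous Besov space $\dot B^s_{p,r}$ is the space of all $f\in\mathcal{S}'/\mathcal{P}$ such that $$\|f\|_{\dot B^s_{p,r}}=\Big\|\big(2^{ms}\|\dot\Delta_m f\|_{L^p}\big)_{m\in\mathbb{Z}}\Big\|_{\ell^r(\mathbb{Z})}<+\infty,$$ with the topology of this norm. Let $\mathcal{S}'_h$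 be the space of those $f\in\mathcal{S}'$ such that $\chi(\lambda\xi)\widehat f(\xi)\to 0$ in $\mathcal{S}'$ as $\lambda\to+\infty$, and let $\mathcal{S}'_h\cap\dot B^s_{p,r}$ denote the subspace of those classes in $\dot B^s_{p,r}$ that have a representative in $\mathcal{S}'_h$. Assume that $s>d/p$, or that $s=d/p$ and $r>1$ (where $d/p=0$ if $p=+\infty$). Then: (i) the subspace $\mathcal{S}'_h\cap\dot B^s_{p,r}$ is not closed in $\dot B^s_{p,r}$; (ii) $\mathcal{S}'_h\cap\dot B^s_{p,r}$ is dense in $\dot B^s_{p,r}$ if and only if $r<+\infty$. -/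

import Mathlib

open MeasureTheory Filter Topology
open scoped SchwartzMap ENNReal NNReal FourierTransform ContDiff LineDeriv

noncomputable section

/-- The space `ℝ^d` with its Euclidean norm. -/
abbrev RSpace (d : ℕ) : Type := EuclideanSpace ℝ (Fin d)

/-! ### Tempered distributions modulo polynomials -/

theorem hasTemperateGrowth_mvPolynomial {d : ℕ} (P : MvPolynomial (Fin d) ℂ) :
    (fun x : RSpace d => MvPolynomial.eval (fun i => ((x i : ℝ) : ℂ)) P).HasTemperateGrowth := by
  induction P using MvPolynomial.induction_on with
  | C a =>
    simp only [MvPolynomial.eval_C]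
    fun_prop
  | add P Q hP hQ =>
    simp only [map_add]
    exact hP.add hQ
  | mul_X P i hP =>
    simp only [map_mul, MvPolynomial.eval_X]
    have h1 : (fun x : RSpace d => inner ℝ x (EuclideanSpace.single i (1 : ℝ))).HasTemperateGrowth := by
      fun_prop
    have h2 : (fun x : RSpace d => ((x i : ℝ) : ℂ)).HasTemperateGrowth := by
      have h3 : (fun x : RSpace d =>
          Complex.ofReal (inner ℝ x (EuclideanSpace.single i (1 : ℝ)))).HasTemperateGrowth := by
        fun_prop
      simpa [EuclideanSpace.inner_single_right] using h3
    exact hP.mul h2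

/-- A polynomial in `d` variables with complex coefficients, viewed as the tempered distribution
`u ↦ ∫ u(x) P(x) dx` on `ℝ^d`. -/
def polynomialDistribution (d : ℕ) : MvPolynomial (Fin d) ℂ →ₗ[ℂ] 𝓢'(RSpace d, ℂ) where
  toFun P := (hasTemperateGrowth_mvPolynomial P).toTemperedDistribution volume
  map_add' P Q := by
    ext u
    have h : ∀ P : MvPolynomial (Fin d) ℂ, Integrable (fun x : RSpace d =>
        u x • MvPolynomial.eval (fun i => ((x i : ℝ) : ℂ)) P) := fun P =>
      (SchwartzMap.bilinLeftCLM (ContinuousLinearMap.lsmul ℂ ℂ)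
        (hasTemperateGrowth_mvPolynomial P) u).integrable
    simp only [Function.HasTemperateGrowth.toTemperedDistribution_apply, map_add, smul_add]
    rw [integral_add (h P) (h Q)]
    simp
  map_smul' c P := by
    ext u
    simp only [Function.HasTemperateGrowth.toTemperedDistribution_apply, MvPolynomial.smul_eval,
      RingHom.id_apply, smul_apply]
    rw [← integral_smul]
    congr 1
    ext x
    simp only [smul_eq_mul]
    ring

/-- The subspace of polynomials in the space of tempered distributions. -/
def polynomials (d : ℕ) : Submodule ℂ 𝓢'(RSpace d, ℂ) :=
  LinearMap.range (polynomialDistribution d)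

/-- Tempered distributions modulo polynomials. -/
abbrev DistModPoly (d : ℕ) : Type := 𝓢'(RSpace d, ℂ) ⧸ polynomials d

/-! ### Littlewood-Paley theory -/

/-- A Littlewood-Paley low frequency cut-off: a smooth radial function supported in the ball
`B(0,2)`, equal to `1` in a neighbourhood of the ball `B(0,1)`, and nonincreasing along rays. -/
structure LowFreqCutoff (d : ℕ) where
  toFun : RSpace d → ℝ
  smooth : ContDiff ℝ ∞ toFun
  radial : ∀ ξ η : RSpace d, ‖ξ‖ = ‖η‖ → toFun ξ = toFun η
  support_subset : tsupport toFun ⊆ Metric.closedBall 0 2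
  eq_one : ∀ᶠ ξ in 𝓝ˢ (Metric.closedBall (0 : RSpace d) 1), toFun ξ = 1
  antitone : ∀ e : RSpace d, ‖e‖ = 1 → AntitoneOn (fun t : ℝ => toFun (t • e)) (Set.Ici 0)

namespace LowFreqCutoff

variable {d : ℕ} (χ : LowFreqCutoff d)

/-- The annulus function `φ(ξ) = χ(ξ) - χ(2ξ)`. -/
def annulus (ξ : RSpace d) : ℝ := χ.toFun ξ - χ.toFun ((2 : ℝ) • ξ)

/-- The complex-valued symbol `φ(2^{-m} ξ)` of the `m`-th dyadic block. -/
def dyadicSymbol (m : ℤ) (ξ : RSpace d) : ℂ := (χ.annulus ((2 : ℝ) ^ (-m) • ξ) : ℂ)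

/-- The dyadic block `φ(2^{-m} D)` acting on tempered distributions. -/
def dyadicBlock (m : ℤ) : 𝓢'(RSpace d, ℂ) →ₗ[ℂ] 𝓢'(RSpace d, ℂ) :=
  (TemperedDistribution.fourierMultiplierCLM ℂ (χ.dyadicSymbol m)).toLinearMap

theorem hasCompactSupport : HasCompactSupport χ.toFun :=
  HasCompactSupport.of_support_subset_isCompact (isCompact_closedBall (0 : RSpace d) 2)
    ((subset_tsupport _).trans χ.support_subset)

theorem dyadicSymbol_hasTemperateGrowth (m : ℤ) : (χ.dyadicSymbol m).HasTemperateGrowth := by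
  have h1 : HasCompactSupport (fun ξ : RSpace d => χ.toFun ((2 : ℝ) ^ (-m) • ξ)) :=
    χ.hasCompactSupport.comp_smul (by positivity)
  have h2 : HasCompactSupport (fun ξ : RSpace d => χ.toFun ((2 : ℝ) • (2 : ℝ) ^ (-m) • ξ)) :=
    (χ.hasCompactSupport.comp_smul (two_ne_zero)).comp_smul (by positivity)
  have h3 : HasCompactSupport (χ.dyadicSymbol m) :=
    (h1.sub h2).comp_left (g := Complex.ofReal) rfl
  refine h3.hasTemperateGrowth ?_
  have h4 := χ.smooth
  have h5 : ContDiff ℝ ∞ (fun ξ : RSpace d => χ.toFun ((2 : ℝ) ^ (-m) • ξ)) := by fun_prop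
  have h6 : ContDiff ℝ ∞ (fun ξ : RSpace d => χ.toFun ((2 : ℝ) • (2 : ℝ) ^ (-m) • ξ)) := by
    fun_prop
  exact Complex.ofRealCLM.contDiff.comp (h5.sub h6)

theorem dyadicSymbol_eventually_zero (m : ℤ) :
    ∀ᶠ ξ in 𝓝 (0 : RSpace d), χ.dyadicSymbol m ξ = 0 := by
  have h0 : ∀ᶠ ξ in 𝓝 (0 : RSpace d), χ.toFun ξ = 1 :=
    χ.eq_one.filter_mono (nhds_le_nhdsSet (by simp))
  have t1 : Tendsto (fun ξ : RSpace d => (2 : ℝ) ^ (-m) • ξ) (𝓝 0) (𝓝 0) := by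
    have : Continuous (fun ξ : RSpace d => (2 : ℝ) ^ (-m) • ξ) := by fun_prop
    simpa using this.tendsto 0
  have t2 : Tendsto (fun ξ : RSpace d => (2 : ℝ) • (2 : ℝ) ^ (-m) • ξ) (𝓝 0) (𝓝 0) := by
    have : Continuous (fun ξ : RSpace d => (2 : ℝ) • (2 : ℝ) ^ (-m) • ξ) := by fun_prop
    simpa using this.tendsto 0
  filter_upwards [t1.eventually h0, t2.eventually h0] with ξ h1 h2
  simp only [dyadicSymbol, annulus, h1, h2, sub_self, Complex.ofReal_zero]

/-- A polynomial annihilates the Fourier transform of a Schwartz function which vanishes near the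
origin. -/
theorem integral_fourier_smul_polynomial (P : MvPolynomial (Fin d) ℂ) :
    ∀ v : 𝓢(RSpace d, ℂ), (∀ᶠ ξ in 𝓝 (0 : RSpace d), v ξ = 0) →
      ∫ x : RSpace d, (𝓕 v) x • MvPolynomial.eval (fun i => ((x i : ℝ) : ℂ)) P = 0 := by
  induction P using MvPolynomial.induction_on with
  | C a =>
    intro v hv
    have h0 : ∫ x : RSpace d, (𝓕 v) x = 0 := by
      have h1 : (𝓕⁻ (𝓕 v)) (0 : RSpace d) = ∫ x : RSpace d, (𝓕 v) x := by
        rw [SchwartzMap.fourierInv_coe, Real.fourierInv_eq]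
        simp
      rw [← h1, FourierTransform.fourierInv_fourier_eq]
      exact hv.self_of_nhds
    simp only [MvPolynomial.eval_C, smul_eq_mul]
    rw [integral_mul_const, h0, zero_mul]
  | add P Q hP hQ =>
    intro v hv
    have h := (polynomialDistribution d).map_add P Q
    have h' := congrArg (fun T : 𝓢'(RSpace d, ℂ) => T (𝓕 v)) h
    have e : ∀ R, polynomialDistribution d R (𝓕 v) =
      ∫ x : RSpace d, (𝓕 v) x • MvPolynomial.eval (fun i => ((x i : ℝ) : ℂ)) R := fun R => rfl
    rw [← e, h, add_apply, e, e, hP v hv, hQ v hv, add_zero]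
  | mul_X P i hP =>
    intro v hv
    have hw : ∀ᶠ ξ in 𝓝 (0 : RSpace d),
        (∂_{(EuclideanSpace.single i (1 : ℝ) : RSpace d)} v) ξ = 0 := by
      filter_upwards [hv.eventually_nhds] with ξ hξ
      have : (v : RSpace d → ℂ) =ᶠ[𝓝 ξ] fun _ => 0 := hξ
      rw [SchwartzMap.lineDerivOp_apply, this.lineDeriv_eq]
      simp [lineDeriv]
    have key := hP _ hw
    have hg : (fun x : RSpace d =>
        inner ℝ x (EuclideanSpace.single i (1 : ℝ))).HasTemperateGrowth := by fun_prop
    rw [SchwartzMap.fourier_lineDerivOp_eq] at key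
    have e : ∀ x : RSpace d, ((2 * Real.pi * Complex.I) •
        SchwartzMap.smulLeftCLM ℂ (inner ℝ · (EuclideanSpace.single i (1 : ℝ))) (𝓕 v)) x •
          MvPolynomial.eval (fun i => ((x i : ℝ) : ℂ)) P =
        (2 * Real.pi * Complex.I) *
          ((𝓕 v) x • MvPolynomial.eval (fun i => ((x i : ℝ) : ℂ)) (P * MvPolynomial.X i)) := by
      intro x
      rw [smul_apply, SchwartzMap.smulLeftCLM_apply_apply hg]
      simp [EuclideanSpace.inner_single_right]
      ring
    simp_rw [e] at key
    rw [integral_const_mul] at key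
    exact (mul_eq_zero.mp key).resolve_left Complex.two_pi_I_ne_zero

/-- The dyadic blocks annihilate polynomials. -/
theorem polynomials_le_ker (m : ℤ) : polynomials d ≤ LinearMap.ker (χ.dyadicBlock m) := by
  rintro _ ⟨P, rfl⟩
  rw [LinearMap.mem_ker]
  ext u
  refine integral_fourier_smul_polynomial P
    (SchwartzMap.smulLeftCLM ℂ (χ.dyadicSymbol m) (𝓕⁻ u)) ?_
  filter_upwards [χ.dyadicSymbol_eventually_zero m] with ξ hξ
  rw [SchwartzMap.smulLeftCLM_apply_apply (χ.dyadicSymbol_hasTemperateGrowth m), hξ, zero_smul]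

/-- The dyadic block `φ(2^{-m} D)` acting on tempered distributions modulo polynomials. -/
def block (m : ℤ) : DistModPoly d →ₗ[ℂ] 𝓢'(RSpace d, ℂ) :=
  (polynomials d).liftQ (χ.dyadicBlock m) (χ.polynomials_le_ker m)

/-- The space `𝓢'_h` of homogeneous distributions: those `f ∈ 𝓢'` such that
`χ(t ξ) f^(ξ) → 0` in `𝓢'` as `t → +∞`. -/
def homogeneousDist : Submodule ℂ 𝓢'(RSpace d, ℂ) where
  carrier := {f | Tendsto (fun t : ℝ =>
    TemperedDistribution.smulLeftCLM ℂ (fun ξ : RSpace d => (χ.toFun (t • ξ) : ℂ)) (𝓕 f))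
    atTop (𝓝 0)}
  add_mem' {f g} hf hg := by
    simp only [Set.mem_ofPred_eq, FourierTransform.fourier_add, map_add] at *
    simpa using hf.add hg
  zero_mem' := by
    simp [FourierTransform.fourier_zero]
  smul_mem' c f hf := by
    simp only [Set.mem_ofPred_eq, FourierTransform.fourier_smul, map_smul] at *
    have h := Tendsto.const_smul hf c
    have h0 : c • (0 : 𝓢'(RSpace d, ℂ)) = 0 := by
      ext u
      exact mul_zero c
    exact h0 ▸ h

end LowFreqCutoff

/-! ### The `L^p` norm of a tempered distribution -/

/-- The `L^p` norm of a tempered distribution, equal to `∞` if the distribution is not (given by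
integration against) an `L^p` function. -/
def distLpNorm {d : ℕ} (p : ℝ≥0∞) [Fact (1 ≤ p)] (f : 𝓢'(RSpace d, ℂ)) : ℝ≥0∞ :=
  ⨅ (g : Lp ℂ p (volume : Measure (RSpace d)))
    (_ : Lp.toTemperedDistribution g = f), ‖g‖ₑ

section distLpNorm

variable {d : ℕ} {p : ℝ≥0∞} [Fact (1 ≤ p)]

theorem distLpNorm_zero : distLpNorm p (0 : 𝓢'(RSpace d, ℂ)) = 0 := by
  refine le_antisymm (iInf₂_le_of_le 0 ?_ (by simp)) zero_le
  exact (Lp.toTemperedDistributionCLM ℂ volume p).map_zero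

theorem distLpNorm_add_le (f g : 𝓢'(RSpace d, ℂ)) :
    distLpNorm p (f + g) ≤ distLpNorm p f + distLpNorm p g := by
  refine ENNReal.le_iInf₂_add_iInf₂ ?_
  rintro a rfl b rfl
  refine iInf₂_le_of_le (a + b) ?_ (enorm_add_le a b)
  exact (Lp.toTemperedDistributionCLM ℂ volume p).map_add a b

theorem distLpNorm_smul_le (c : ℂ) (f : 𝓢'(RSpace d, ℂ)) :
    distLpNorm p (c • f) ≤ ‖c‖ₑ * distLpNorm p f := by
  unfold distLpNorm
  rcases eq_or_ne c 0 with rfl | hc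
  · refine iInf₂_le_of_le 0 ?_ (by simp)
    exact (Lp.toTemperedDistributionCLM ℂ volume p).map_zero.trans (zero_smul ℂ f).symm
  · rw [ENNReal.mul_iInf_of_ne (by simpa using hc) (by simp)]
    refine le_iInf fun a => ?_
    rw [ENNReal.mul_iInf_of_ne (by simpa using hc) (by simp)]
    refine le_iInf fun ha => ?_
    refine iInf₂_le_of_le (c • a) ?_ (enorm_smul c a).le
    rw [← ha]
    exact (Lp.toTemperedDistributionCLM ℂ volume p).map_smul c a

end distLpNorm

/-! ### Homogeneous Besov spaces -/

/-- The homogeneous Besov norm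
`‖ (2^{ms} ‖Δ_m f‖_{L^p})_{m ∈ ℤ} ‖_{ℓ^r(ℤ)}`, with values in `[0, ∞]`, of a class of
tempered distributions modulo polynomials. -/
def besovENorm {d : ℕ} (χ : LowFreqCutoff d) (s : ℝ) (p r : ℝ≥0∞) [Fact (1 ≤ p)]
    (f : DistModPoly d) : ℝ≥0∞ :=
  eLpNorm (fun m : ℤ => (2 : ℝ≥0∞) ^ ((m : ℝ) * s) * distLpNorm p (χ.block m f)) r Measure.count

section besovENorm

variable {d : ℕ} (χ : LowFreqCutoff d) (s : ℝ) (p r : ℝ≥0∞) [Fact (1 ≤ p)]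

theorem besovENorm_zero : besovENorm χ s p r 0 = 0 := by
  simp [besovENorm, distLpNorm_zero]

theorem besovENorm_add_le [Fact (1 ≤ r)] (f g : DistModPoly d) :
    besovENorm χ s p r (f + g) ≤ besovENorm χ s p r f + besovENorm χ s p r g := by
  unfold besovENorm
  refine le_trans (eLpNorm_mono_enorm (fun m => ?_)) (eLpNorm_add_le
    (measurable_of_countable _).aestronglyMeasurable
    (measurable_of_countable _).aestronglyMeasurable Fact.out)
  simp only [enorm_eq_self, map_add, Pi.add_apply, ← mul_add]
  gcongr
  exact distLpNorm_add_le _ _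

theorem besovENorm_smul_le (c : ℂ) (f : DistModPoly d) :
    besovENorm χ s p r (c • f) ≤ ‖c‖ₑ * besovENorm χ s p r f := by
  unfold besovENorm
  refine eLpNorm_le_nnreal_smul_eLpNorm_of_ae_le_mul' (c := ‖c‖₊)
    (Eventually.of_forall fun m => ?_) r
  simp only [enorm_eq_self, map_smul]
  refine (mul_le_mul_right (distLpNorm_smul_le c _) _).trans (le_of_eq ?_)
  rw [enorm_eq_nnnorm]
  ring

end besovENorm

/-- The homogeneous Besov space as a linear subspace of the space of tempered distributions modulo
polynomials. -/
def besovSubmodule {d : ℕ} (χ : LowFreqCutoff d) (s : ℝ) (p r : ℝ≥0∞) [Fact (1 ≤ p)]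
    [Fact (1 ≤ r)] : Submodule ℂ (DistModPoly d) where
  carrier := {f | besovENorm χ s p r f < ⊤}
  add_mem' hf hg := (besovENorm_add_le χ s p r _ _).trans_lt (ENNReal.add_lt_top.2 ⟨hf, hg⟩)
  zero_mem' := by simp [besovENorm_zero]
  smul_mem' c f hf := (besovENorm_smul_le χ s p r c f).trans_lt (ENNReal.mul_lt_top (by simp) hf)

/-- The homogeneous Besov space `Ḃ^s_{p,r}(ℝ^d)`. It is a type of its own, so that its topology is
the one of the Besov norm and not the one inherited from distributions. -/
def BesovSpace {d : ℕ} (χ : LowFreqCutoff d) (s : ℝ) (p r : ℝ≥0∞) [Fact (1 ≤ p)]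
    [Fact (1 ≤ r)] : Type :=
  besovSubmodule χ s p r

namespace BesovSpace

variable {d : ℕ} (χ : LowFreqCutoff d) (s : ℝ) (p r : ℝ≥0∞) [Fact (1 ≤ p)] [Fact (1 ≤ r)]

instance : AddCommGroup (BesovSpace χ s p r) :=
  inferInstanceAs (AddCommGroup (besovSubmodule χ s p r))

instance : Module ℂ (BesovSpace χ s p r) :=
  inferInstanceAs (Module ℂ (besovSubmodule χ s p r))

/-- The inclusion of the Besov space into tempered distributions modulo polynomials. -/
def incl : BesovSpace χ s p r →ₗ[ℂ] DistModPoly d := (besovSubmodule χ s p r).subtype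

instance : Norm (BesovSpace χ s p r) where
  norm f := (besovENorm χ s p r (incl χ s p r f)).toReal

theorem besovENorm_ne_top (f : BesovSpace χ s p r) : besovENorm χ s p r (incl χ s p r f) ≠ ⊤ :=
  (show besovENorm χ s p r (incl χ s p r f) < ⊤ from f.2).ne

theorem norm_smul_le' (c : ℂ) (f : BesovSpace χ s p r) : ‖c • f‖ ≤ ‖c‖ * ‖f‖ := by
  have h := besovENorm_smul_le χ s p r c (incl χ s p r f)
  rw [← map_smul] at h
  have h' := ENNReal.toReal_mono
    (ENNReal.mul_ne_top (by simp) (besovENorm_ne_top χ s p r f)) h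
  rwa [ENNReal.toReal_mul, toReal_enorm] at h'

theorem seminormedCore : SeminormedSpace.Core ℂ (BesovSpace χ s p r) where
  norm_nonneg _ := ENNReal.toReal_nonneg
  norm_smul c f := by
    refine le_antisymm (norm_smul_le' χ s p r c f) ?_
    rcases eq_or_ne c 0 with rfl | hc
    · rw [norm_zero, zero_mul]
      exact ENNReal.toReal_nonneg
    · have h := norm_smul_le' χ s p r c⁻¹ (c • f)
      rw [smul_smul, inv_mul_cancel₀ hc, one_smul, norm_inv] at h
      have hc' : 0 < ‖c‖ := norm_pos_iff.2 hc
      rwa [inv_mul_eq_div, le_div_iff₀ hc', mul_comm] at h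
  norm_triangle f g := by
    have h := besovENorm_add_le χ s p r (incl χ s p r f) (incl χ s p r g)
    rw [← map_add] at h
    have h' := ENNReal.toReal_mono (ENNReal.add_ne_top.2
      ⟨besovENorm_ne_top χ s p r f, besovENorm_ne_top χ s p r g⟩) h
    rwa [ENNReal.toReal_add (besovENorm_ne_top χ s p r f) (besovENorm_ne_top χ s p r g)] at h'

/-- The Besov space carries the topology of its norm. -/
instance : SeminormedAddCommGroup (BesovSpace χ s p r) :=
  SeminormedAddCommGroup.ofCore (seminormedCore χ s p r)

/-- The subspace `𝓢'_h ∩ Ḃ^s_{p,r}` of the Besov space: those classes modulo polynomials which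
have a representative in `𝓢'_h`. -/
def homogeneousPart : Submodule ℂ (BesovSpace χ s p r) :=
  (χ.homogeneousDist.map (polynomials d).mkQ).comap (incl χ s p r)

end BesovSpace

end

/-! Write δ = s - d/p. The pairing of the Fourier transform of f with φ(2^(-m) ξ) depends only on
the class of f modulo polynomials, because φ vanishes near the origin, and Bernstein's inequality
bounds it by a constant times 2^(m d/p) times the `Lᵖ` norm of the m-th block. These pairings
telescope over m = 0, -1, -2, ...; if f lies in `𝓢'_h`, the remainder, the pairing with χ(2^n ξ),
tends to 0, so their sum converges (`tendsto_sum_pairing`). A class whose pairings have a sum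
diverging to +∞ therefore has no representative in `𝓢'_h` (`notMem_homogeneousPart`).

Such classes are lacunary: the Fourier transform is formally ∑ a_j 2^(jd) θ(2^j ξ), with θ a
nonnegative bump on which φ is 1 and every other dyadic symbol vanishes. The pairing of index -j is
then c a_j, and the `Lᵖ` norm of the block is of order a_j 2^(j d/p), so the class lies in the Besov
space when a_j 2^(-jδ) is in `ℓʳ`. The series need not converge in `𝓢'`, but it converges on
Schwartz functions vanishing near 0, which are flat there, and Hahn-Banach extends it to a tempered
distribution (`exists_lacunary_extension`).

In the other direction, f - χ(2^n D) f always belongs to `𝓢'_h`, and the norm of χ(2^n D) f is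
controlled by the blocks of f of index below 3 - n. A class with vanishing low-frequency tails is
therefore a limit of homogeneous ones (`mem_closure_homogeneousPart`). This gives density for finite
r. It also refutes closedness: the hypothesis on s, p, r is what allows ∑ a_j to diverge while a_j
2^(-jδ) is in `ℓʳ` and tends to 0 (`exists_coeff`). For r = ∞ take a_j = 2^(jδ): by Bernstein, every
class close enough to this one still has pairings of real part at least c/2, so a whole ball misses
`𝓢'_h`. -/

noncomputable section

/-! ### Young's inequality `L¹ * Lᵖ ⊆ Lᵖ` -/

section Young

variable {d : ℕ}

theorem eLpNorm_integral_mul_sub_le {κ g : RSpace d → ℂ} (hκ : Measurable κ)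
    (hg : StronglyMeasurable g) {p : ℝ≥0∞} (hp : 1 ≤ p) :
    eLpNorm (fun y => ∫ t, κ t * g (y - t)) p volume ≤
      eLpNorm κ 1 volume * eLpNorm g p volume := by
  have hle : ∀ y, ‖∫ t, κ t * g (y - t)‖ₑ ≤ ∫⁻ t, ‖κ t‖ₑ * ‖g (y - t)‖ₑ := fun y =>
    (enorm_integral_le_lintegral_enorm _).trans (by simp [enorm_mul])
  have hgm : Measurable g := hg.measurable
  rcases eq_or_ne p ⊤ with rfl | hpt
  · rw [eLpNorm_exponent_top, eLpNorm_exponent_top, eLpNorm_one_eq_lintegral_enorm,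
      ← lintegral_mul_const _ hκ.enorm]
    refine essSup_le_of_ae_le _ (Eventually.of_forall fun y => (hle y).trans ?_)
    refine lintegral_mono_ae ?_
    have h1 : ∀ᵐ t : RSpace d, ‖g (y - t)‖ₑ ≤ eLpNormEssSup g volume :=
      (Measure.measurePreserving_sub_left volume y).quasiMeasurePreserving.ae
        (enorm_ae_le_eLpNormEssSup g volume)
    filter_upwards [h1] with t ht
    gcongr
  · have hp0 : p ≠ 0 := (zero_lt_one.trans_le hp).ne'
    set q := p.toReal with hq
    have hq1 : 1 ≤ q := by
      rw [hq, ← ENNReal.toReal_one]; exact ENNReal.toReal_mono hpt hp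
    have hq0 : 0 < q := by linarith
    -- Jensen's inequality for the measure |κ| dt, of mass ‖κ‖₁, followed by Tonelli and translation
    -- invariance.
    set ν : Measure (RSpace d) := volume.withDensity (fun t => ‖κ t‖ₑ) with hν
    have hνu : ν Set.univ = eLpNorm κ 1 volume := by
      rw [eLpNorm_one_eq_lintegral_enorm, hν, withDensity_apply _ MeasurableSet.univ,
        Measure.restrict_univ]
    have hνint : ∀ F : RSpace d → ℝ≥0∞, Measurable F →
        ∫⁻ t, F t ∂ν = ∫⁻ t, ‖κ t‖ₑ * F t := fun F hF => by
      rw [hν, lintegral_withDensity_eq_lintegral_mul _ hκ.enorm hF]; rfl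
    have hpt1 : ∀ y, ‖∫ t, κ t * g (y - t)‖ₑ ^ q ≤
        (∫⁻ t, ‖κ t‖ₑ * ‖g (y - t)‖ₑ ^ q) * eLpNorm κ 1 volume ^ (q - 1) := by
      intro y
      have hm : Measurable fun t => g (y - t) := by fun_prop
      have h1 := eLpNorm_le_eLpNorm_mul_rpow_measure_univ (μ := ν) hp
        (hm.aestronglyMeasurable : AEStronglyMeasurable (fun t => g (y - t)) ν)
      rw [eLpNorm_one_eq_lintegral_enorm, hνint _ hm.enorm,
        eLpNorm_eq_lintegral_rpow_enorm_toReal hp0 hpt, hνint _ (hm.enorm.pow_const _), hνu,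
        ← hq] at h1
      have h2 := ENNReal.rpow_le_rpow ((hle y).trans h1) hq0.le
      refine h2.trans (le_of_eq ?_)
      rw [ENNReal.mul_rpow_of_nonneg _ _ hq0.le, ← ENNReal.rpow_mul, ← ENNReal.rpow_mul]
      congr 2
      · rw [one_div, inv_mul_cancel₀ hq0.ne', ENNReal.rpow_one]
      · simp; field_simp
    have h3 : ∫⁻ y, ‖∫ t, κ t * g (y - t)‖ₑ ^ q ≤
        (eLpNorm κ 1 volume * ∫⁻ y, ‖g y‖ₑ ^ q) * eLpNorm κ 1 volume ^ (q - 1) := by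
      have hm2 : Measurable fun z : RSpace d × RSpace d =>
          ‖κ z.2‖ₑ * ‖g (z.1 - z.2)‖ₑ ^ q := by fun_prop
      refine (lintegral_mono hpt1).trans ?_
      rw [lintegral_mul_const _ hm2.lintegral_prod_right']
      gcongr
      rw [lintegral_lintegral_swap hm2.aemeasurable, eLpNorm_one_eq_lintegral_enorm,
        ← lintegral_mul_const _ hκ.enorm]
      refine lintegral_mono fun t => ?_
      have hm3 : Measurable fun y => ‖g (y - t)‖ₑ ^ q := by fun_prop
      change ∫⁻ y, ‖κ t‖ₑ * ‖g (y - t)‖ₑ ^ q ≤ _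
      rw [lintegral_const_mul _ hm3, lintegral_sub_right_eq_self (fun y => ‖g y‖ₑ ^ q) t]
    rw [eLpNorm_eq_lintegral_rpow_enorm_toReal hp0 hpt,
      eLpNorm_eq_lintegral_rpow_enorm_toReal hp0 hpt, ← hq]
    refine (ENNReal.rpow_le_rpow h3 (by positivity)).trans ?_
    have h4 : eLpNorm κ 1 volume * eLpNorm κ 1 volume ^ (q - 1) = eLpNorm κ 1 volume ^ q := by
      conv_lhs => rw [← ENNReal.rpow_one (eLpNorm κ 1 volume), ← ENNReal.rpow_mul, one_mul]
      rw [← ENNReal.rpow_add_of_nonneg _ _ zero_le_one (by linarith)]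
      ring_nf
    rw [mul_right_comm, h4, ENNReal.mul_rpow_of_nonneg _ _ (by positivity), ← ENNReal.rpow_mul,
      mul_one_div_cancel hq0.ne', ENNReal.rpow_one]

/-- The composition of a Schwartz function with the homothety of ratio `c`. -/
def SchwartzMap.dilate (c : ℝˣ) : 𝓢(RSpace d, ℂ) →L[ℂ] 𝓢(RSpace d, ℂ) :=
  SchwartzMap.compCLMOfContinuousLinearEquiv ℂ
    (ContinuousLinearEquiv.smulLeft c : RSpace d ≃L[ℝ] RSpace d)

theorem SchwartzMap.dilate_apply (c : ℝˣ) (f : 𝓢(RSpace d, ℂ)) (x : RSpace d) :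
    SchwartzMap.dilate c f x = f ((c : ℝ) • x) := rfl

theorem SchwartzMap.fourier_dilate (c : ℝˣ) (f : 𝓢(RSpace d, ℂ)) (x : RSpace d) :
    𝓕 (SchwartzMap.dilate c f) x = |((c : ℝ) ^ d)⁻¹| • 𝓕 f ((c : ℝ)⁻¹ • x) := by
  rw [SchwartzMap.fourier_coe, SchwartzMap.fourier_coe, Real.fourier_eq, Real.fourier_eq]
  have h := Measure.integral_comp_smul (volume : Measure (RSpace d))
    (fun v => 𝐞 (-inner ℝ v ((c : ℝ)⁻¹ • x)) • f v) (c : ℝ)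
  rw [finrank_euclideanSpace_fin] at h
  rw [← h]
  congr 1
  ext v
  rw [SchwartzMap.dilate_apply, inner_smul_left, inner_smul_right]
  simp

/-- Change of variables. At q = ∞ the convention d/0 = 0 gives exponent 0, the correct scaling of
the supremum norm. -/
theorem SchwartzMap.eLpNorm_dilate (c : ℝˣ) (hc : 0 < (c : ℝ)) (f : 𝓢(RSpace d, ℂ))
    (q : ℝ≥0∞) : eLpNorm (SchwartzMap.dilate c f) q volume =
      ENNReal.ofReal ((c : ℝ) ^ (-(d / q.toReal) : ℝ)) * eLpNorm f q volume := by
  have h1 := Measure.map_addHaar_smul (volume : Measure (RSpace d)) c.ne_zero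
  rw [finrank_euclideanSpace_fin] at h1
  have h2 : eLpNorm f q (Measure.map ((c : ℝ) • ·) (volume : Measure (RSpace d))) =
      eLpNorm (SchwartzMap.dilate c f) q volume :=
    eLpNorm_map_measure f.continuous.aestronglyMeasurable (by fun_prop)
  have h3 : 0 < |((c : ℝ) ^ d)⁻¹| := by positivity
  rw [← h2, h1, eLpNorm_smul_measure_of_ne_zero (by simp), smul_eq_mul,
    ENNReal.ofReal_rpow_of_pos h3, abs_of_pos (by positivity)]
  congr 2
  rw [ENNReal.toReal_div, ENNReal.toReal_one, ← Real.rpow_natCast, ← Real.rpow_neg hc.le,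
    ← Real.rpow_mul hc.le]
  ring_nf

theorem SchwartzMap.eLpNorm_fourier_dilate (c : ℝˣ) (hc : 0 < (c : ℝ)) (f : 𝓢(RSpace d, ℂ))
    (q : ℝ≥0∞) : eLpNorm (𝓕 (SchwartzMap.dilate c f) : 𝓢(RSpace d, ℂ)) q volume =
      ENNReal.ofReal ((c : ℝ) ^ (d / q.toReal - d : ℝ)) * eLpNorm (𝓕 f : 𝓢(RSpace d, ℂ)) q volume := by
  have h1 : ((𝓕 (SchwartzMap.dilate c f) : 𝓢(RSpace d, ℂ)) : RSpace d → ℂ) =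
      |((c : ℝ) ^ d)⁻¹| • (SchwartzMap.dilate c⁻¹ (𝓕 f : 𝓢(RSpace d, ℂ)) : RSpace d → ℂ) := by
    ext x
    rw [SchwartzMap.fourier_dilate, Pi.smul_apply, SchwartzMap.dilate_apply, Units.val_inv_eq_inv_val]
  rw [h1, eLpNorm_const_smul, SchwartzMap.eLpNorm_dilate _ (by simpa using hc), ← mul_assoc,
    Real.enorm_eq_ofReal_abs, abs_abs, ← ENNReal.ofReal_mul (abs_nonneg _)]
  congr 2
  rw [abs_of_pos (by positivity), Units.val_inv_eq_inv_val, Real.inv_rpow hc.le,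
    ← Real.rpow_neg hc.le, ← Real.rpow_natCast, ← Real.rpow_neg hc.le, ← Real.rpow_add hc]
  ring_nf

theorem SchwartzMap.fourierInv_apply_eq_fourier_neg (f : 𝓢(RSpace d, ℂ)) (x : RSpace d) :
    𝓕⁻ f x = 𝓕 f (-x) := by
  rw [SchwartzMap.fourierInv_coe, SchwartzMap.fourier_coe, Real.fourierInv_eq_fourier_neg]

theorem SchwartzMap.eLpNorm_fourierInv (f : 𝓢(RSpace d, ℂ)) (q : ℝ≥0∞) :
    eLpNorm (𝓕⁻ f : 𝓢(RSpace d, ℂ)) q volume = eLpNorm (𝓕 f : 𝓢(RSpace d, ℂ)) q volume := by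
  have h1 : ((𝓕⁻ f : 𝓢(RSpace d, ℂ)) : RSpace d → ℂ) =
      ((𝓕 f : 𝓢(RSpace d, ℂ)) : RSpace d → ℂ) ∘ Neg.neg := by
    ext x; exact SchwartzMap.fourierInv_apply_eq_fourier_neg f x
  rw [h1, eLpNorm_comp_measurePreserving (𝓕 f).continuous.aestronglyMeasurable
    (Measure.measurePreserving_neg volume)]

/-- The convolution theorem applied to the reflection of u, evaluated at -x. The left side is the
transpose by which a multiplier acts on distributions, so this exhibits its kernel. -/
theorem SchwartzMap.fourier_smulLeft_fourierInv_apply (σ u : 𝓢(RSpace d, ℂ)) (x : RSpace d) :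
    𝓕 (SchwartzMap.smulLeftCLM ℂ σ (𝓕⁻ u)) x = ∫ t, (𝓕⁻ σ) t * u (x + t) := by
  have h1 : 𝓕 (SchwartzMap.dilate (-1) u) = 𝓕⁻ u := by
    ext y
    rw [SchwartzMap.fourier_dilate, SchwartzMap.fourierInv_apply_eq_fourier_neg]
    simp
  have h2 : SchwartzMap.convolution (ContinuousLinearMap.mul ℂ ℂ) (𝓕⁻ σ)
      (SchwartzMap.dilate (-1) u) = 𝓕⁻ (SchwartzMap.smulLeftCLM ℂ σ (𝓕⁻ u)) := by
    rw [← FourierTransform.fourierInv_fourier_eq (F := 𝓢(RSpace d, ℂ)) (SchwartzMap.convolution _ _ _),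
      SchwartzMap.fourier_convolution, FourierTransform.fourier_fourierInv_eq, h1]
    congr 1
    ext y
    rw [SchwartzMap.smulLeftCLM_apply_apply σ.hasTemperateGrowth]
    rfl
  have h3 := congrArg (fun f : 𝓢(RSpace d, ℂ) => f (-x)) h2
  simp only [SchwartzMap.fourierInv_apply_eq_fourier_neg (SchwartzMap.smulLeftCLM ℂ σ (𝓕⁻ u)),
    neg_neg] at h3
  rw [← h3, SchwartzMap.convolution_apply, convolution_def]
  congr 1
  ext t
  simp [SchwartzMap.dilate_apply]
  left
  congr 1
  abel

/-! ### Convolution of `Lᵖ` functions with Schwartz kernels -/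

theorem integrable_mul_mul_sub (κ u : 𝓢(RSpace d, ℂ)) {p : ℝ≥0∞} [hp : Fact (1 ≤ p)]
    {g : RSpace d → ℂ} (hgm : Measurable g) (hgp : MemLp g p volume) :
    Integrable (Function.uncurry fun y t => u y * (κ t * g (y - t)))
      ((volume : Measure (RSpace d)).prod volume) := by
  have := ENNReal.HolderConjugate.inv_one_sub_inv' hp.out
  have : ENNReal.HolderTriple (1 - p⁻¹)⁻¹ p 1 := ENNReal.HolderConjugate.symm
  have hsub : ∀ t, MemLp (fun y => g (y - t)) p volume := fun t =>
    hgp.comp_measurePreserving (measurePreserving_sub_right volume t)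
  have hup := u.memLp (1 - p⁻¹)⁻¹ (volume : Measure (RSpace d))
  have hm : Measurable (Function.uncurry fun y t => u y * (κ t * g (y - t))) := by
    have := κ.continuous.measurable
    have := u.continuous.measurable
    unfold Function.uncurry
    fun_prop
  -- Integrating in y first, Hölder with the conjugate exponent bounds the inner integral uniformly
  -- in t, since translations preserve the `Lᵖ` norm; κ is integrable in t.
  rw [integrable_prod_iff' hm.aestronglyMeasurable]
  have hI : ∀ t, Integrable (fun y => u y * g (y - t)) volume := fun t =>
    hup.integrable_mul (hsub t)
  have he : ∀ y t, u y * (κ t * g (y - t)) = κ t * (u y * g (y - t)) := fun y t => by ring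
  simp only [Function.uncurry, he]
  refine ⟨Eventually.of_forall fun t => (hI t).const_mul _, ?_⟩
  simp only [norm_mul (κ _), integral_const_mul]
  refine Integrable.mul_bdd (c := (eLpNorm u (1 - p⁻¹)⁻¹ volume * eLpNorm g p volume).toReal)
    κ.integrable.norm ?_ (Eventually.of_forall fun t => ?_)
  · have hm2 : Measurable (fun z : RSpace d × RSpace d => ‖u z.2 * g (z.2 - z.1)‖) := by
      have := u.continuous.measurable
      fun_prop
    exact (hm2.stronglyMeasurable.integral_prod_right').aestronglyMeasurable
  · rw [Real.norm_of_nonneg (integral_nonneg fun _ => norm_nonneg _)]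
    rw [integral_norm_eq_lintegral_enorm (hI t).1, ← eLpNorm_one_eq_lintegral_enorm]
    refine ENNReal.toReal_mono (ENNReal.mul_ne_top hup.2.ne hgp.2.ne) ?_
    have h5 := eLpNorm_smul_le_mul_eLpNorm (p := (1 - p⁻¹)⁻¹) (q := p) (r := 1)
      (hsub t).1 hup.1
    refine h5.trans (le_of_eq ?_)
    congr 1
    exact eLpNorm_comp_measurePreserving hgp.1 (measurePreserving_sub_right volume t)

theorem integral_mul_integral_mul_sub (κ u : 𝓢(RSpace d, ℂ)) {p : ℝ≥0∞} [hp : Fact (1 ≤ p)]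
    {g : RSpace d → ℂ} (hgm : Measurable g) (hgp : MemLp g p volume) :
    ∫ y, u y * ∫ t, κ t * g (y - t) = ∫ x, (∫ t, κ t * u (x + t)) * g x := by
  have hint := integrable_mul_mul_sub κ u hgm hgp
  -- The shear (x, t) ↦ (x + t, t) preserves the measure, so Fubini also applies after the
  -- substitution y = x + t.
  have h6 := (measurePreserving_add_prod (volume : Measure (RSpace d))
    (volume : Measure (RSpace d))).integrable_comp_of_integrable hint
  simp only [Function.comp_def, Function.uncurry, add_sub_cancel_right] at h6
  calc ∫ y, u y * ∫ t, κ t * g (y - t)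
      = ∫ y, ∫ t, u y * (κ t * g (y - t)) := by simp only [integral_const_mul]
    _ = ∫ t, ∫ y, u y * (κ t * g (y - t)) := integral_integral_swap hint
    _ = ∫ t, ∫ x, u (x + t) * (κ t * g x) := by
        congr 1
        ext t
        rw [← integral_add_right_eq_self (fun y => u y * (κ t * g (y - t))) t]
        simp only [add_sub_cancel_right]
    _ = ∫ x, ∫ t, u (x + t) * (κ t * g x) := (integral_integral_swap h6).symm
    _ = _ := by
        congr 1
        ext x
        rw [← integral_mul_const]
        congr 1
        ext t
        ring

theorem memLp_integral_mul_sub (κ : 𝓢(RSpace d, ℂ)) {p : ℝ≥0∞} (hp : 1 ≤ p)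
    {g : RSpace d → ℂ} (hgs : StronglyMeasurable g) (hgp : MemLp g p volume) :
    MemLp (fun y => ∫ t, κ t * g (y - t)) p volume := by
  have hgm : Measurable g := hgs.measurable
  have hm : Measurable (fun z : RSpace d × RSpace d => κ z.2 * g (z.1 - z.2)) := by
    have := κ.continuous.measurable
    fun_prop
  have hs : StronglyMeasurable (fun y => ∫ t, κ t * g (y - t)) :=
    hm.stronglyMeasurable.integral_prod_right
  exact ⟨hs.aestronglyMeasurable,
    (eLpNorm_integral_mul_sub_le κ.continuous.measurable hgs hp).trans_lt
      (ENNReal.mul_lt_top (κ.memLp 1 volume).2 hgp.2)⟩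

/-- A Fourier multiplier with Schwartz symbol acts on `Lᵖ` as the convolution with its kernel. -/
theorem exists_fourierMultiplier_toTemperedDistribution (σ : 𝓢(RSpace d, ℂ)) {p : ℝ≥0∞}
    [hp : Fact (1 ≤ p)] (g : Lp ℂ p (volume : Measure (RSpace d))) :
    ∃ h : Lp ℂ p (volume : Measure (RSpace d)),
      Lp.toTemperedDistribution h =
        TemperedDistribution.fourierMultiplierCLM ℂ σ (Lp.toTemperedDistribution g) ∧
      ‖h‖ₑ ≤ eLpNorm (𝓕 σ : 𝓢(RSpace d, ℂ)) 1 volume * ‖g‖ₑ := by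
  have hgs : StronglyMeasurable g := Lp.stronglyMeasurable g
  have hmem := memLp_integral_mul_sub (𝓕⁻ σ) hp.out hgs (Lp.memLp g)
  refine ⟨hmem.toLp _, ?_, ?_⟩
  · ext u
    rw [TemperedDistribution.fourierMultiplierCLM_apply_apply, Lp.toTemperedDistribution_apply,
      Lp.toTemperedDistribution_apply]
    simp only [smul_eq_mul, SchwartzMap.fourier_smulLeft_fourierInv_apply]
    rw [← integral_mul_integral_mul_sub (𝓕⁻ σ) u hgs.measurable (Lp.memLp g)]
    refine integral_congr_ae ?_
    filter_upwards [hmem.coeFn_toLp] with y hy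
    rw [hy]
  · rw [Lp.enorm_toLp, Lp.enorm_def, ← SchwartzMap.eLpNorm_fourierInv]
    exact eLpNorm_integral_mul_sub_le (SchwartzMap.continuous _).measurable hgs hp.out

end Young


/-! ### Estimates on the `Lᵖ` norm of distributions -/

section distLpNormEstimates

variable {d : ℕ} {p : ℝ≥0∞} [hp : Fact (1 ≤ p)]

/-- The infimum may be over an empty set and equal ∞; C ≠ 0 keeps the right side infinite then. This
is why 1 is added to the constants below. -/
theorem le_mul_distLpNorm {T : 𝓢'(RSpace d, ℂ)} {a C : ℝ≥0∞} (hC0 : C ≠ 0) (hCt : C ≠ ⊤)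
    (h : ∀ g : Lp ℂ p (volume : Measure (RSpace d)), Lp.toTemperedDistribution g = T →
      a ≤ C * ‖g‖ₑ) : a ≤ C * distLpNorm p T := by
  unfold distLpNorm
  rw [ENNReal.mul_iInf_of_ne hC0 hCt]
  refine le_iInf fun g => ?_
  rw [ENNReal.mul_iInf_of_ne hC0 hCt]
  exact le_iInf fun hg => h g hg

/-- Hölder's inequality for the duality pairing. -/
theorem enorm_apply_le_mul_distLpNorm (T : 𝓢'(RSpace d, ℂ)) (v : 𝓢(RSpace d, ℂ)) {C : ℝ≥0∞}
    (hC0 : C ≠ 0) (hCt : C ≠ ⊤) (hv : eLpNorm v (1 - p⁻¹)⁻¹ volume ≤ C) :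
    ‖T v‖ₑ ≤ C * distLpNorm p T := by
  refine le_mul_distLpNorm hC0 hCt ?_
  rintro g rfl
  rw [Lp.toTemperedDistribution_apply]
  have := ENNReal.HolderConjugate.inv_one_sub_inv' hp.out
  have : ENNReal.HolderTriple (1 - p⁻¹)⁻¹ p 1 := ENNReal.HolderConjugate.symm
  refine (enorm_integral_le_lintegral_enorm _).trans ?_
  rw [← eLpNorm_one_eq_lintegral_enorm]
  refine (eLpNorm_smul_le_mul_eLpNorm (p := (1 - p⁻¹)⁻¹) (q := p) (r := 1)
    (Lp.memLp g).1 (v.memLp (1 - p⁻¹)⁻¹ volume).1).trans ?_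
  rw [Lp.enorm_def]
  gcongr

theorem distLpNorm_fourierMultiplier_le (σ : 𝓢(RSpace d, ℂ)) (T : 𝓢'(RSpace d, ℂ)) {C : ℝ≥0∞}
    (hC0 : C ≠ 0) (hCt : C ≠ ⊤) (hσ : eLpNorm (𝓕 σ : 𝓢(RSpace d, ℂ)) 1 volume ≤ C) :
    distLpNorm p (TemperedDistribution.fourierMultiplierCLM ℂ σ T) ≤ C * distLpNorm p T := by
  refine le_mul_distLpNorm hC0 hCt ?_
  rintro g rfl
  obtain ⟨h, h1, h2⟩ := exists_fourierMultiplier_toTemperedDistribution σ g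
  exact (iInf₂_le h h1).trans (h2.trans (by gcongr))

theorem distLpNorm_toTemperedDistributionCLM_le (f : 𝓢(RSpace d, ℂ)) :
    distLpNorm p (SchwartzMap.toTemperedDistributionCLM (RSpace d) ℂ volume f) ≤
      eLpNorm f p volume := by
  refine (iInf₂_le (f.toLp p volume) (Lp.toTemperedDistribution_toLp_eq f)).trans (le_of_eq ?_)
  exact Lp.enorm_toLp _

end distLpNormEstimates

/-! ### Low frequency truncations -/

/-- The unit `2` of `ℝ`. -/
def twoUnit : ℝˣ := Units.mk0 2 two_ne_zero

theorem val_twoUnit_zpow (n : ℤ) : ((twoUnit ^ n : ℝˣ) : ℝ) = (2 : ℝ) ^ n := by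
  rw [Units.val_zpow_eq_zpow_val]; rfl

namespace LowFreqCutoff

variable {d : ℕ} (χ : LowFreqCutoff d)

theorem eq_one_of_norm_le {ξ : RSpace d} (h : ‖ξ‖ ≤ 1) : χ.toFun ξ = 1 :=
  χ.eq_one.self_of_nhdsSet ξ (by simpa using h)

theorem eq_zero_of_lt_norm {ξ : RSpace d} (h : 2 < ‖ξ‖) : χ.toFun ξ = 0 := by
  by_contra h0
  have := χ.support_subset (subset_tsupport _ h0)
  simp at this
  linarith

/-- The cut-off as a Schwartz function. -/
def toSchwartz : 𝓢(RSpace d, ℂ) :=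
  HasCompactSupport.toSchwartzMap (f := fun ξ => (χ.toFun ξ : ℂ))
    (χ.hasCompactSupport.comp_left (g := Complex.ofReal) rfl)
    (Complex.ofRealCLM.contDiff.comp χ.smooth)

/-- The Schwartz function `χ(2^n ξ)`. -/
def lowSymbol (n : ℤ) : 𝓢(RSpace d, ℂ) := SchwartzMap.dilate (twoUnit ^ n) χ.toSchwartz

theorem lowSymbol_apply (n : ℤ) (ξ : RSpace d) :
    χ.lowSymbol n ξ = (χ.toFun ((2 : ℝ) ^ n • ξ) : ℂ) := by
  rw [lowSymbol, SchwartzMap.dilate_apply, val_twoUnit_zpow]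
  rfl

theorem norm_zpow_smul (n : ℤ) (ξ : RSpace d) : ‖(2 : ℝ) ^ n • ξ‖ = 2 ^ n * ‖ξ‖ := by
  rw [norm_smul, Real.norm_of_nonneg (by positivity)]

theorem lowSymbol_eq_one {n : ℤ} {ξ : RSpace d} (h : 2 ^ n * ‖ξ‖ ≤ 1) : χ.lowSymbol n ξ = 1 := by
  rw [lowSymbol_apply, χ.eq_one_of_norm_le (by rwa [norm_zpow_smul]), Complex.ofReal_one]

theorem lowSymbol_eq_zero {n : ℤ} {ξ : RSpace d} (h : 2 < 2 ^ n * ‖ξ‖) :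
    χ.lowSymbol n ξ = 0 := by
  rw [lowSymbol_apply, χ.eq_zero_of_lt_norm (by rwa [norm_zpow_smul]), Complex.ofReal_zero]

theorem dyadicSymbol_eq (m : ℤ) (ξ : RSpace d) :
    χ.dyadicSymbol m ξ = χ.lowSymbol (-m) ξ - χ.lowSymbol (1 - m) ξ := by
  rw [lowSymbol_apply, lowSymbol_apply, dyadicSymbol, annulus, smul_smul, sub_eq_add_neg 1 m,
    zpow_add₀ two_ne_zero, zpow_one, Complex.ofReal_sub]

theorem eLpNorm_fourier_lowSymbol (n : ℤ) (q : ℝ≥0∞) :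
    eLpNorm (𝓕 (χ.lowSymbol n) : 𝓢(RSpace d, ℂ)) q volume =
      ENNReal.ofReal (((2 : ℝ) ^ n) ^ (d / q.toReal - d : ℝ)) *
        eLpNorm (𝓕 χ.toSchwartz : 𝓢(RSpace d, ℂ)) q volume := by
  rw [lowSymbol, SchwartzMap.eLpNorm_fourier_dilate _ (by rw [val_twoUnit_zpow]; positivity),
    val_twoUnit_zpow]

/-- On the support of χ(2^n ξ) one has 2^n |ξ| ≤ 2, hence 2^k |ξ| ≤ 1, where the other factor is 1.
-/
theorem lowSymbol_mul_of_lt {n k : ℤ} (h : k < n) (ξ : RSpace d) :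
    χ.lowSymbol n ξ * χ.lowSymbol k ξ = χ.lowSymbol n ξ := by
  rcases le_or_gt (2 ^ k * ‖ξ‖) 1 with h1 | h1
  · rw [χ.lowSymbol_eq_one h1, mul_one]
  · rw [χ.lowSymbol_eq_zero (n := n), zero_mul]
    calc (2 : ℝ) < 2 * (2 ^ k * ‖ξ‖) := by linarith
      _ = 2 ^ (k + 1) * ‖ξ‖ := by rw [zpow_add₀ two_ne_zero, zpow_one]; ring
      _ ≤ 2 ^ n * ‖ξ‖ := by
        gcongr
        · norm_num
        · omega

/-- The pairing of the Fourier transform of a class modulo polynomials with the symbol of the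
`m`-th dyadic block. -/
def pairing (m : ℤ) (x : DistModPoly d) : ℂ :=
  χ.block m x (𝓕 (χ.lowSymbol (-m - 1)))

theorem pairing_sub (m : ℤ) (x y : DistModPoly d) :
    χ.pairing m (x - y) = χ.pairing m x - χ.pairing m y := by
  rw [pairing, map_sub, sub_apply]; rfl

theorem block_mk_apply (m : ℤ) (f : 𝓢'(RSpace d, ℂ)) (u : 𝓢(RSpace d, ℂ)) :
    χ.block m ((polynomials d).mkQ f) u =
      𝓕 f (SchwartzMap.smulLeftCLM ℂ (χ.dyadicSymbol m) (𝓕⁻ u)) := rfl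

/-- The test symbol χ(2^(-m-1) ξ) is 1 on the support of the dyadic symbol, so only φ(2^(-m) ξ)
remains, a difference of consecutive cut-offs: the form that telescopes. -/
theorem pairing_mk (m : ℤ) (f : 𝓢'(RSpace d, ℂ)) :
    χ.pairing m ((polynomials d).mkQ f) =
      𝓕 f (χ.lowSymbol (-m)) - 𝓕 f (χ.lowSymbol (1 - m)) := by
  rw [pairing, block_mk_apply, FourierTransform.fourierInv_fourier_eq, ← map_sub]
  congr 1
  ext ξ
  rw [SchwartzMap.smulLeftCLM_apply_apply (χ.dyadicSymbol_hasTemperateGrowth m), sub_apply,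
    dyadicSymbol_eq, smul_eq_mul, sub_mul, χ.lowSymbol_mul_of_lt (by omega),
    χ.lowSymbol_mul_of_lt (by omega)]

theorem hasTemperateGrowth_comp_smul {t : ℝ} (ht : t ≠ 0) :
    (fun ξ : RSpace d => (χ.toFun (t • ξ) : ℂ)).HasTemperateGrowth :=
  (SchwartzMap.dilate (Units.mk0 t ht) χ.toSchwartz).hasTemperateGrowth

/-- For `f ∈ 𝓢'_h` the series of pairings with the dyadic symbols at low frequencies converges. -/
theorem tendsto_sum_pairing {f : 𝓢'(RSpace d, ℂ)} (hf : f ∈ χ.homogeneousDist) :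
    Tendsto (fun n : ℕ => ∑ j ∈ Finset.range n, χ.pairing (-(j : ℤ)) ((polynomials d).mkQ f))
      atTop (𝓝 (𝓕 f (χ.lowSymbol 0))) := by
  have h1 : ∀ n : ℕ, ∑ j ∈ Finset.range n, χ.pairing (-(j : ℤ)) ((polynomials d).mkQ f) =
      𝓕 f (χ.lowSymbol 0) - 𝓕 f (χ.lowSymbol n) := by
    intro n
    induction n with
    | zero => simp
    | succ n ih =>
      rw [Finset.sum_range_succ, ih, pairing_mk, neg_neg, sub_neg_eq_add, add_comm (1 : ℤ)]
      push_cast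
      ring
  have h2 : Tendsto (fun n : ℕ => 𝓕 f (χ.lowSymbol n)) atTop (𝓝 0) := by
    have hf' : Tendsto (fun t : ℝ => TemperedDistribution.smulLeftCLM ℂ
      (fun ξ : RSpace d => (χ.toFun (t • ξ) : ℂ)) (𝓕 f)) atTop (𝓝 0) := hf
    rw [PointwiseConvergenceCLM.tendsto_nhds] at hf'
    -- The test function χ(ξ/2) is 1 on the support of χ(2^n ξ) for n ≥ 0, so restricting to t = 2^n
    -- recovers the pairing with χ(2^n ξ) itself.
    have h5 : Tendsto (fun t : ℝ => TemperedDistribution.smulLeftCLM ℂ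
        (fun ξ : RSpace d => (χ.toFun (t • ξ) : ℂ)) (𝓕 f) (χ.lowSymbol (-1))) atTop (𝓝 0) := by
      rw [Metric.tendsto_nhds]
      intro ε hε
      filter_upwards [hf' (χ.lowSymbol (-1)) ε hε] with t ht
      rwa [dist_eq_norm]
    have h3 := h5.comp
      (tendsto_pow_atTop_atTop_of_one_lt (one_lt_two (α := ℝ)))
    refine h3.congr fun n => ?_
    simp only [Function.comp_apply, TemperedDistribution.smulLeftCLM_apply_apply]
    congr 1
    ext ξ
    rw [SchwartzMap.smulLeftCLM_apply_apply (χ.hasTemperateGrowth_comp_smul (by positivity))]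
    have h4 := χ.lowSymbol_mul_of_lt (n := n) (k := -1) (by omega) ξ
    rw [← h4, χ.lowSymbol_apply n, zpow_natCast, smul_eq_mul]
  simp only [h1]
  simpa using h2.const_sub (𝓕 f (χ.lowSymbol 0))

/-- The low frequency part `χ(2^n D) f`. -/
def low (n : ℤ) : 𝓢'(RSpace d, ℂ) →L[ℂ] 𝓢'(RSpace d, ℂ) :=
  TemperedDistribution.fourierMultiplierCLM ℂ (χ.lowSymbol n)

/-- The product χ(tξ)(1 - χ(2^n ξ)) is identically zero once t ≥ 2^(n+1), so the limit is eventually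
constant. -/
theorem sub_low_mem_homogeneousDist (n : ℤ) (f : 𝓢'(RSpace d, ℂ)) :
    f - χ.low n f ∈ χ.homogeneousDist := by
  change Tendsto (fun t : ℝ => TemperedDistribution.smulLeftCLM ℂ
    (fun ξ : RSpace d => (χ.toFun (t • ξ) : ℂ)) (𝓕 (f - χ.low n f))) atTop (𝓝 0)
  refine tendsto_const_nhds.congr' ?_
  filter_upwards [eventually_ge_atTop ((2 : ℝ) ^ (n + 1))] with t ht
  have ht0 : 0 < t := lt_of_lt_of_le (by positivity) ht
  have h0 : 𝓕 (f - χ.low n f) = 𝓕 f - 𝓕 (χ.low n f) :=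
    (FourierTransform.fourierCLM ℂ 𝓢'(RSpace d, ℂ)).map_sub _ _
  ext u
  rw [TemperedDistribution.smulLeftCLM_apply_apply, h0, sub_apply, low,
    TemperedDistribution.fourierMultiplierCLM_apply, FourierTransform.fourier_fourierInv_eq,
    TemperedDistribution.smulLeftCLM_apply_apply]
  refine (sub_eq_zero.2 ?_).symm
  congr 1
  ext ξ
  rw [SchwartzMap.smulLeftCLM_apply_apply (χ.lowSymbol n).hasTemperateGrowth,
    SchwartzMap.smulLeftCLM_apply_apply (χ.hasTemperateGrowth_comp_smul ht0.ne')]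
  rcases le_or_gt (2 ^ n * ‖ξ‖) 1 with h1 | h1
  · rw [χ.lowSymbol_eq_one h1, one_smul]
  · rw [χ.eq_zero_of_lt_norm]
    · simp
    · rw [norm_smul, Real.norm_of_nonneg ht0.le]
      calc (2 : ℝ) < 2 * (2 ^ n * ‖ξ‖) := by linarith
        _ = 2 ^ (n + 1) * ‖ξ‖ := by rw [zpow_add₀ two_ne_zero, zpow_one]; ring
        _ ≤ t * ‖ξ‖ := by gcongr

theorem block_low (m n : ℤ) (f : 𝓢'(RSpace d, ℂ)) :
    χ.block m ((polynomials d).mkQ (χ.low n f)) =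
      TemperedDistribution.fourierMultiplierCLM ℂ (χ.lowSymbol n)
        (χ.block m ((polynomials d).mkQ f)) := by
  change TemperedDistribution.fourierMultiplierCLM ℂ _
    (TemperedDistribution.fourierMultiplierCLM ℂ _ f) =
    TemperedDistribution.fourierMultiplierCLM ℂ _
    (TemperedDistribution.fourierMultiplierCLM ℂ _ f)
  rw [TemperedDistribution.fourierMultiplierCLM_fourierMultiplierCLM_apply
      (χ.lowSymbol n).hasTemperateGrowth (χ.dyadicSymbol_hasTemperateGrowth m),
    TemperedDistribution.fourierMultiplierCLM_fourierMultiplierCLM_apply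
      (χ.dyadicSymbol_hasTemperateGrowth m) (χ.lowSymbol n).hasTemperateGrowth, mul_comm]

/-- Disjoint frequency supports. The blocks already vanish from index 2 - n on; the bound leaves one
index of slack. -/
theorem block_low_eq_zero {m n : ℤ} (h : 3 - n ≤ m) (f : 𝓢'(RSpace d, ℂ)) :
    χ.block m ((polynomials d).mkQ (χ.low n f)) = 0 := by
  ext u
  rw [block_low, TemperedDistribution.fourierMultiplierCLM_apply_apply, block_mk_apply,
    FourierTransform.fourierInv_fourier_eq]
  have h1 : SchwartzMap.smulLeftCLM ℂ (χ.dyadicSymbol m)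
      (SchwartzMap.smulLeftCLM ℂ (χ.lowSymbol n) (𝓕⁻ u)) = 0 := by
    ext ξ
    rw [SchwartzMap.smulLeftCLM_apply_apply (χ.dyadicSymbol_hasTemperateGrowth m),
      SchwartzMap.smulLeftCLM_apply_apply (χ.lowSymbol n).hasTemperateGrowth, smul_smul,
      dyadicSymbol_eq, sub_mul, mul_comm, χ.lowSymbol_mul_of_lt (by omega), mul_comm,
      χ.lowSymbol_mul_of_lt (by omega), sub_self, zero_smul]
    rfl
  rw [h1, map_zero]
  rfl

/-- Young's inequality; the constant is uniform in n because the `L¹` norm of the kernel is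
invariant under dilation of the symbol. -/
theorem exists_distLpNorm_block_low_le (p : ℝ≥0∞) [Fact (1 ≤ p)] :
    ∃ C : ℝ≥0, ∀ (m n : ℤ) (f : 𝓢'(RSpace d, ℂ)),
      distLpNorm p (χ.block m ((polynomials d).mkQ (χ.low n f))) ≤
        C * distLpNorm p (χ.block m ((polynomials d).mkQ f)) := by
  have h0 : eLpNorm (𝓕 χ.toSchwartz : 𝓢(RSpace d, ℂ)) 1 volume ≠ ⊤ :=
    ((𝓕 χ.toSchwartz : 𝓢(RSpace d, ℂ)).memLp 1 volume).2.ne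
  refine ⟨(eLpNorm (𝓕 χ.toSchwartz : 𝓢(RSpace d, ℂ)) 1 volume).toNNReal + 1, fun m n f => ?_⟩
  rw [block_low]
  refine distLpNorm_fourierMultiplier_le _ _ (by simp) (by simp) ?_
  rw [eLpNorm_fourier_lowSymbol, ENNReal.coe_add, ENNReal.coe_toNNReal h0]
  simp

/-- Bernstein's inequality for the pairings with the dyadic symbols. -/
theorem exists_enorm_pairing_le (p : ℝ≥0∞) [hp : Fact (1 ≤ p)] :
    ∃ C : ℝ≥0, ∀ (m : ℤ) (x : DistModPoly d),
      ‖χ.pairing m x‖ₑ ≤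
        C * (2 : ℝ≥0∞) ^ ((m : ℝ) * (d / p.toReal)) * distLpNorm p (χ.block m x) := by
  set q := (1 - p⁻¹)⁻¹ with hq
  have h0 : eLpNorm (𝓕 χ.toSchwartz : 𝓢(RSpace d, ℂ)) q volume ≠ ⊤ :=
    ((𝓕 χ.toSchwartz : 𝓢(RSpace d, ℂ)).memLp q volume).2.ne
  -- q is the exponent conjugate to p, so the scaling exponent d/q - d equals -d/p.
  have hqr : d / q.toReal - d = -(d / p.toReal : ℝ) := by
    rw [hq, ENNReal.toReal_inv, ENNReal.toReal_sub_of_le (ENNReal.inv_le_one.2 hp.out) (by simp)]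
    simp
    ring
  -- The factor 2^(d/p) pays for testing at scale -m - 1 instead of -m.
  refine ⟨(((2 : ℝ≥0) ^ (d / p.toReal : ℝ))) *
    ((eLpNorm (𝓕 χ.toSchwartz : 𝓢(RSpace d, ℂ)) q volume).toNNReal + 1), fun m x => ?_⟩
  have hpos : (2 : ℝ≥0∞) ^ ((m : ℝ) * (d / p.toReal)) ≠ 0 := by simp
  have hfin : (2 : ℝ≥0∞) ^ ((m : ℝ) * (d / p.toReal)) ≠ ⊤ := by simp
  refine enorm_apply_le_mul_distLpNorm _ _ ?_ (ENNReal.mul_ne_top ENNReal.coe_ne_top hfin) ?_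
  · refine mul_ne_zero ?_ hpos
    rw [ENNReal.coe_ne_zero]
    positivity
  · rw [← hq, eLpNorm_fourier_lowSymbol, hqr, ENNReal.coe_mul, ENNReal.coe_add,
      ENNReal.coe_toNNReal h0, mul_right_comm]
    gcongr
    · rw [← Real.rpow_intCast, ← Real.rpow_mul zero_le_two, ← ENNReal.ofReal_rpow_of_pos two_pos,
        ENNReal.coe_rpow_of_ne_zero two_ne_zero, ENNReal.coe_ofNat, ENNReal.ofReal_ofNat,
        ← ENNReal.rpow_add _ _ two_ne_zero ENNReal.ofNat_ne_top]
      refine le_of_eq ?_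
      congr 1
      push_cast
      ring
    · exact le_self_add

end LowFreqCutoff


/-! ### Lacunary distributions -/

section Vanishing

variable {d : ℕ}

/-- Taylor's estimate at a point where all derivatives vanish: each step of the induction integrates
the bound on the next derivative by the mean value inequality on the ball of radius ‖ξ‖. -/
theorem norm_iteratedFDeriv_le_of_eventually_zero {v : 𝓢(RSpace d, ℂ)}
    (hv : ∀ᶠ ξ in 𝓝 (0 : RSpace d), v ξ = 0) (N k : ℕ) :
    ∀ i, i + k = N → ∀ ξ : RSpace d,
      ‖iteratedFDeriv ℝ i v ξ‖ ≤ SchwartzMap.seminorm ℂ 0 N v * ‖ξ‖ ^ k := by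
  induction k with
  | zero =>
    rintro i rfl ξ
    simpa using SchwartzMap.norm_iteratedFDeriv_le_seminorm ℂ v i ξ
  | succ k ih =>
    intro i hi ξ
    have h0 : iteratedFDeriv ℝ i v 0 = 0 := by
      by_contra h
      exact notMem_tsupport_iff_eventuallyEq.2 hv (support_iteratedFDeriv_subset i h)
    have hdiff : Differentiable ℝ (iteratedFDeriv ℝ i v) :=
      (v.smooth ⊤).differentiable_iteratedFDeriv (by exact_mod_cast WithTop.coe_lt_top i)
    have h2 := Convex.norm_image_sub_le_of_norm_fderiv_le (𝕜 := ℝ) (f := iteratedFDeriv ℝ i v)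
      (s := Metric.closedBall (0 : RSpace d) ‖ξ‖) (x := 0) (y := ξ)
      (C := SchwartzMap.seminorm ℂ 0 N v * ‖ξ‖ ^ k) (fun z _ => hdiff z) (fun z hz => ?_)
      (convex_closedBall _ _) (by simp) (by simp)
    · rw [h0, sub_zero, sub_zero] at h2
      rwa [pow_succ, ← mul_assoc]
    · rw [norm_fderiv_iteratedFDeriv]
      refine (ih (i + 1) (by omega) z).trans ?_
      have : ‖z‖ ≤ ‖ξ‖ := by simpa using hz
      gcongr

theorem toTemperedDistributionCLM_apply_eq_integral (f u : 𝓢(RSpace d, ℂ)) :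
    SchwartzMap.toTemperedDistributionCLM (RSpace d) ℂ volume f u = ∫ x, u x * f x :=
  SchwartzMap.toTemperedDistributionCLM_apply_apply volume f u

/-- Schwartz functions vanishing near the origin. -/
def vanishingNearZero (d : ℕ) : Submodule ℂ 𝓢(RSpace d, ℂ) where
  carrier := {v | ∀ᶠ ξ in 𝓝 (0 : RSpace d), v ξ = 0}
  add_mem' := by
    intro u v hu hv
    filter_upwards [hu, hv] with ξ h1 h2
    rw [add_apply, h1, h2, add_zero]
  zero_mem' := Eventually.of_forall fun _ => rfl
  smul_mem' := by
    intro c u hu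
    filter_upwards [hu] with ξ h1
    rw [smul_apply, h1, smul_zero]

/-- The functional `v ↦ ∫ θ(η) v(2^{-j} η) dη`. -/
def dilatedPairing (θ : 𝓢(RSpace d, ℂ)) (j : ℕ) : 𝓢(RSpace d, ℂ) →ₗ[ℂ] ℂ :=
  ((SchwartzMap.toTemperedDistributionCLM (RSpace d) ℂ volume θ).toLinearMap).comp
    (SchwartzMap.dilate (twoUnit ^ (-(j : ℤ)))).toLinearMap

theorem dilatedPairing_apply (θ : 𝓢(RSpace d, ℂ)) (j : ℕ) (v : 𝓢(RSpace d, ℂ)) :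
    dilatedPairing θ j v = ∫ η, v ((2 : ℝ) ^ (-(j : ℤ)) • η) * θ η := by
  refine (toTemperedDistributionCLM_apply_eq_integral θ
    (SchwartzMap.dilate (twoUnit ^ (-(j : ℤ))) v)).trans ?_
  simp only [SchwartzMap.dilate_apply, val_twoUnit_zpow]

/-- Flatness of v at the origin to order N: for |η| ≤ 2 the value v(2^(-j) η) is O(2^(-jN)). Any
geometric growth of coefficients can thus be absorbed. -/
theorem norm_dilatedPairing_le {θ : 𝓢(RSpace d, ℂ)} (hθ : ∀ ξ, θ ξ ≠ 0 → ‖ξ‖ ≤ 2) (N j : ℕ)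
    {v : 𝓢(RSpace d, ℂ)} (hv : v ∈ vanishingNearZero d) :
    ‖dilatedPairing θ j v‖ ≤
      ((2 : ℝ) ^ N * ∫ η, ‖θ η‖) * SchwartzMap.seminorm ℂ 0 N v * ((1 / 2 : ℝ) ^ N) ^ j := by
  rw [dilatedPairing_apply]
  have h1 : ∀ η, ‖v ((2 : ℝ) ^ (-(j : ℤ)) • η) * θ η‖ ≤
      (2 : ℝ) ^ N * SchwartzMap.seminorm ℂ 0 N v * ((1 / 2 : ℝ) ^ N) ^ j * ‖θ η‖ := by
    intro η
    rw [norm_mul]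
    rcases eq_or_ne (θ η) 0 with h | h
    · simp [h]
    · gcongr
      have h2 := norm_iteratedFDeriv_le_of_eventually_zero hv N N 0 (by simp)
        ((2 : ℝ) ^ (-(j : ℤ)) • η)
      rw [norm_iteratedFDeriv_zero] at h2
      refine h2.trans ?_
      rw [LowFreqCutoff.norm_zpow_smul, mul_pow]
      have h3 : ((2 : ℝ) ^ (-(j : ℤ))) ^ N = ((1 / 2 : ℝ) ^ N) ^ j := by
        rw [zpow_neg, zpow_natCast, one_div, inv_pow, inv_pow, inv_pow, ← pow_mul, ← pow_mul,
          mul_comm]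
      rw [h3]
      have h4 : ‖η‖ ^ N ≤ 2 ^ N := by gcongr; exact hθ η h
      have h5 : 0 ≤ SchwartzMap.seminorm ℂ 0 N v := apply_nonneg _ _
      calc SchwartzMap.seminorm ℂ 0 N v * (((1 / 2 : ℝ) ^ N) ^ j * ‖η‖ ^ N)
          ≤ SchwartzMap.seminorm ℂ 0 N v * (((1 / 2 : ℝ) ^ N) ^ j * 2 ^ N) := by gcongr
        _ = _ := by ring
  refine (norm_integral_le_of_norm_le (θ.integrable.norm.const_mul _)
    (Eventually.of_forall h1)).trans (le_of_eq ?_)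
  rw [integral_const_mul]
  ring

/-- A lacunary series of dilates of `θ`, with coefficients of at most geometric growth, extends
from the Schwartz functions vanishing near the origin to a tempered distribution. -/
theorem exists_lacunary_extension {θ : 𝓢(RSpace d, ℂ)} (hθ : ∀ ξ, θ ξ ≠ 0 → ‖ξ‖ ≤ 2) (M : ℕ)
    {a : ℕ → ℝ} (ha0 : ∀ j, 0 ≤ a j) (ha : ∀ j, a j ≤ (2 ^ M) ^ j) :
    ∃ T : StrongDual ℂ 𝓢(RSpace d, ℂ), ∀ v ∈ vanishingNearZero d,
      T v = ∑' j, (a j : ℂ) * dilatedPairing θ j v := by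
  -- Using order M + 1, one more than the growth of a, leaves the ratio 2^M · 2^(-(M+1)) = 1/2.
  set C : ℝ := (2 : ℝ) ^ (M + 1) * ∫ η, ‖θ η‖ with hC
  have hC0 : 0 ≤ C := mul_nonneg (by positivity) (integral_nonneg fun _ => norm_nonneg _)
  have hb : ∀ v ∈ vanishingNearZero d, ∀ j, ‖(a j : ℂ) * dilatedPairing θ j v‖ ≤
      C * SchwartzMap.seminorm ℂ 0 (M + 1) v * (1 / 2 : ℝ) ^ j := by
    intro v hv j
    have h5 : 0 ≤ SchwartzMap.seminorm ℂ 0 (M + 1) v := apply_nonneg _ _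
    rw [norm_mul, Complex.norm_real, Real.norm_of_nonneg (ha0 j)]
    calc a j * ‖dilatedPairing θ j v‖ ≤ (2 ^ M) ^ j *
          (C * SchwartzMap.seminorm ℂ 0 (M + 1) v * ((1 / 2 : ℝ) ^ (M + 1)) ^ j) :=
          mul_le_mul (ha j) (norm_dilatedPairing_le hθ (M + 1) j hv) (norm_nonneg _)
            (by positivity)
      _ = C * SchwartzMap.seminorm ℂ 0 (M + 1) v *
          ((2 : ℝ) ^ M * (1 / 2 : ℝ) ^ (M + 1)) ^ j := by rw [mul_pow]; ring
      _ = _ := by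
        congr 2
        rw [pow_succ, ← mul_assoc, ← mul_pow]
        norm_num
  have hgeo : ∀ v : 𝓢(RSpace d, ℂ), Summable fun j : ℕ =>
      C * SchwartzMap.seminorm ℂ 0 (M + 1) v * (1 / 2 : ℝ) ^ j :=
    fun v => summable_geometric_two.mul_left _
  have hs : ∀ v ∈ vanishingNearZero d, Summable fun j => (a j : ℂ) * dilatedPairing θ j v :=
    fun v hv => Summable.of_norm_bounded (hgeo v) (hb v hv)
  let f : Module.Dual ℂ (vanishingNearZero d) :=
    { toFun := fun v => ∑' j, (a j : ℂ) * dilatedPairing θ j v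
      map_add' := fun u v => by
        rw [← (hs u u.2).tsum_add (hs v v.2)]
        simp [mul_add]
      map_smul' := fun c v => by
        rw [RingHom.id_apply, smul_eq_mul, ← tsum_mul_left]
        congr 1
        ext j
        simp
        ring }
  let B : ℝ≥0 := ⟨C * 2, by positivity⟩
  let q : Seminorm ℂ 𝓢(RSpace d, ℂ) := SchwartzMap.seminorm ℂ 0 (M + 1)
  have hq : Continuous q :=
    (schwartz_withSeminorms ℂ (RSpace d) ℂ).continuous_seminorm (0, M + 1)
  have hcont : Continuous (B • q) := by
    rw [FunLike.coe_smul]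
    exact hq.const_smul B
  have := (schwartz_withSeminorms ℂ (RSpace d) ℂ).toPolynormableSpace
  -- Hahn-Banach: on the subspace, the sum is dominated by 2C times a single continuous Schwartz
  -- seminorm.
  obtain ⟨T, hT, -⟩ := Module.Dual.exists_continuous_extension_of_le_seminorm
    (vanishingNearZero d) f hcont (fun v => by
      refine (tsum_of_norm_bounded (hgeo v).hasSum (hb v v.2)).trans (le_of_eq ?_)
      rw [tsum_mul_left, tsum_geometric_two]
      change _ = C * 2 * SchwartzMap.seminorm ℂ 0 (M + 1) (v : 𝓢(RSpace d, ℂ))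
      ring)
  exact ⟨T, fun v hv => hT ⟨v, hv⟩⟩

end Vanishing

/-! ### Dyadic blocks of lacunary distributions -/

namespace LowFreqCutoff

variable {d : ℕ} (χ : LowFreqCutoff d)

/-- There is a nonnegative bump supported where the symbol of the block of index `0` is `1`. -/
theorem exists_bump (hd : 1 ≤ d) :
    ∃ θ : 𝓢(RSpace d, ℂ), ∃ c : ℝ, 0 < c ∧ ∫ η, θ η = c ∧
      ∀ ξ, θ ξ ≠ 0 → 1 < ‖ξ‖ ∧ ‖ξ‖ ≤ 2 ∧ χ.toFun ξ = 1 := by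
  set e : RSpace d := EuclideanSpace.single ⟨0, hd⟩ 1 with he
  have hen : ‖e‖ = 1 := by simp [he]
  have h1 : ∀ᶠ ξ in 𝓝 e, χ.toFun ξ = 1 :=
    χ.eq_one.filter_mono (nhds_le_nhdsSet (by simp [hen]))
  obtain ⟨δ, hδ, h2⟩ := Metric.eventually_nhds_iff.1 h1
  set δ' := min δ 1 with hδ'
  have hδ0 : 0 < δ' := lt_min hδ one_pos
  -- Since χ is 1 slightly beyond the unit sphere, a ball of radius δ'/4 centred at distance δ'/2
  -- outside it fits in the region where |ξ| > 1 and χ = 1.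
  let b : ContDiffBump ((1 + δ' / 2) • e) :=
    { rIn := δ' / 8, rOut := δ' / 4, rIn_pos := by positivity, rIn_lt_rOut := by linarith }
  have hbs : HasCompactSupport fun ξ => (b ξ : ℂ) :=
    b.hasCompactSupport.comp_left (g := Complex.ofReal) rfl
  refine ⟨hbs.toSchwartzMap (Complex.ofRealCLM.contDiff.comp b.contDiff), ∫ ξ, b ξ,
    b.integral_pos, integral_ofReal, fun ξ hξ => ?_⟩
  have h3 : ξ ∈ Function.support b := by
    intro h
    apply hξ
    change ((b ξ : ℝ) : ℂ) = 0
    rw [h, Complex.ofReal_zero]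
  rw [b.support_eq, Metric.mem_ball, dist_eq_norm] at h3
  change ‖ξ - (1 + δ' / 2) • e‖ < δ' / 4 at h3
  have h4 : ‖(1 + δ' / 2) • e‖ = 1 + δ' / 2 := by
    rw [norm_smul, hen, mul_one, Real.norm_of_nonneg (by positivity)]
  have h5 : ‖(1 + δ' / 2) • e - e‖ = δ' / 2 := by
    rw [add_smul, one_smul, add_sub_cancel_left, norm_smul, hen, mul_one,
      Real.norm_of_nonneg (by positivity)]
  have h6 := norm_sub_norm_le ξ ((1 + δ' / 2) • e)
  have h7 := norm_sub_norm_le ((1 + δ' / 2) • e) ξ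
  rw [norm_sub_rev] at h7
  have h8 := norm_sub_le_norm_sub_add_norm_sub ξ ((1 + δ' / 2) • e) e
  have h9 : δ' ≤ 1 := min_le_right _ _
  have h10 : δ' ≤ δ := min_le_left _ _
  refine ⟨by linarith, by linarith, h2 ?_⟩
  rw [dist_eq_norm]
  linarith

/-- At such a ξ, χ(2^k ξ) is 1 for k ≤ 0 and 0 for k ≥ 1, so the difference of consecutive cut-offs
detects exactly one index. -/
theorem dyadicSymbol_zpow_smul {ξ : RSpace d} (h1 : 1 < ‖ξ‖) (h2 : ‖ξ‖ ≤ 2)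
    (h3 : χ.toFun ξ = 1) (m : ℤ) (j : ℕ) :
    χ.dyadicSymbol m ((2 : ℝ) ^ (-(j : ℤ)) • ξ) = if m = -(j : ℤ) then 1 else 0 := by
  have hχ : ∀ k : ℤ, χ.lowSymbol k ξ = if k ≤ 0 then 1 else 0 := by
    intro k
    split_ifs with hk
    · rcases hk.eq_or_lt with rfl | hk
      · rw [lowSymbol_apply, zpow_zero, one_smul, h3, Complex.ofReal_one]
      · refine χ.lowSymbol_eq_one ?_
        calc (2 : ℝ) ^ k * ‖ξ‖ ≤ 2 ^ (-1 : ℤ) * 2 := by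
              gcongr
              · norm_num
              · omega
          _ = 1 := by norm_num
    · refine χ.lowSymbol_eq_zero ?_
      calc (2 : ℝ) < 2 ^ (1 : ℤ) * ‖ξ‖ := by rw [zpow_one]; linarith
        _ ≤ 2 ^ k * ‖ξ‖ := by
          gcongr
          · norm_num
          · omega
  have hs : ∀ k : ℤ, χ.lowSymbol k ((2 : ℝ) ^ (-(j : ℤ)) • ξ) = χ.lowSymbol (k - j) ξ := by
    intro k
    rw [lowSymbol_apply, lowSymbol_apply, smul_smul, ← zpow_add₀ two_ne_zero, sub_eq_add_neg]
  rw [dyadicSymbol_eq, hs, hs, hχ, hχ]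
  split_ifs <;> first | omega | simp

theorem dilatedPairing_smulLeft {θ : 𝓢(RSpace d, ℂ)}
    (hθ : ∀ ξ, θ ξ ≠ 0 → 1 < ‖ξ‖ ∧ ‖ξ‖ ≤ 2 ∧ χ.toFun ξ = 1) (m : ℤ) (j : ℕ)
    (v : 𝓢(RSpace d, ℂ)) :
    dilatedPairing θ j (SchwartzMap.smulLeftCLM ℂ (χ.dyadicSymbol m) v) =
      if m = -(j : ℤ) then dilatedPairing θ j v else 0 := by
  have h1 : ∀ η, SchwartzMap.smulLeftCLM ℂ (χ.dyadicSymbol m) v ((2 : ℝ) ^ (-(j : ℤ)) • η) * θ η =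
      if m = -(j : ℤ) then v ((2 : ℝ) ^ (-(j : ℤ)) • η) * θ η else 0 := by
    intro η
    rcases eq_or_ne (θ η) 0 with h | h
    · simp [h]
    · obtain ⟨h1, h2, h3⟩ := hθ η h
      rw [SchwartzMap.smulLeftCLM_apply_apply (χ.dyadicSymbol_hasTemperateGrowth m),
        χ.dyadicSymbol_zpow_smul h1 h2 h3]
      split_ifs <;> simp
  rw [dilatedPairing_apply, dilatedPairing_apply]
  simp only [h1]
  split_ifs <;> simp

theorem dilatedPairing_lowSymbol {θ : 𝓢(RSpace d, ℂ)} (hθ : ∀ ξ, θ ξ ≠ 0 → ‖ξ‖ ≤ 2) (j : ℕ) :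
    dilatedPairing θ j (χ.lowSymbol (j - 1)) = ∫ η, θ η := by
  rw [dilatedPairing_apply]
  congr 1
  ext η
  rcases eq_or_ne (θ η) 0 with h | h
  · simp [h]
  · rw [χ.lowSymbol_eq_one, one_mul]
    rw [norm_zpow_smul, ← mul_assoc, ← zpow_add₀ two_ne_zero]
    have : (j : ℤ) - 1 + -(j : ℤ) = -1 := by ring
    rw [this]
    have := hθ η h
    norm_num
    linarith

/-- The substitution η = 2^j ξ turns the functional into integration against 2^(jd) θ(2^j ξ). Its
inverse Fourier transform is a Schwartz function, whose `Lᵖ` norm scales explicitly. -/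
theorem dilatedPairing_fourierInv (θ u : 𝓢(RSpace d, ℂ)) (j : ℕ) :
    dilatedPairing θ j (𝓕⁻ u) = SchwartzMap.toTemperedDistributionCLM (RSpace d) ℂ volume
      ((((2 : ℝ) ^ j) ^ d : ℂ) • 𝓕⁻ (SchwartzMap.dilate (twoUnit ^ (j : ℤ)) θ)) u := by
  rw [map_smul, ← TemperedDistribution.fourierInv_toTemperedDistributionCLM_eq, smul_apply,
    TemperedDistribution.fourierInv_apply, toTemperedDistributionCLM_apply_eq_integral,
    dilatedPairing_apply]
  have h := Measure.integral_comp_smul (volume : Measure (RSpace d))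
    (fun η => (𝓕⁻ u) η * θ ((2 : ℝ) ^ (j : ℤ) • η)) ((2 : ℝ) ^ (-(j : ℤ)))
  simp only [smul_smul, ← zpow_add₀ (two_ne_zero (α := ℝ)), add_neg_cancel, zpow_zero,
    one_smul] at h
  rw [h, finrank_euclideanSpace_fin, abs_of_pos (by positivity), Complex.real_smul, smul_eq_mul]
  congr 1
  simp

/-- Lacunary classes of distributions, with prescribed pairings with the dyadic symbols. -/
theorem exists_lacunary (hd : 1 ≤ d) (p : ℝ≥0∞) [Fact (1 ≤ p)] :
    ∃ K : ℝ≥0, ∃ c : ℝ, 0 < c ∧ ∀ (M : ℕ) (a : ℕ → ℝ), (∀ j, 0 ≤ a j) →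
      (∀ j, a j ≤ (2 ^ M) ^ j) → ∃ x : DistModPoly d,
        (∀ j : ℕ, χ.pairing (-(j : ℤ)) x = (c * a j : ℝ)) ∧
        (∀ m : ℤ, 0 < m → χ.block m x = 0) ∧
        ∀ j : ℕ, distLpNorm p (χ.block (-(j : ℤ)) x) ≤
          K * (2 : ℝ≥0∞) ^ ((j : ℝ) * (d / p.toReal)) * ENNReal.ofReal (a j) := by
  obtain ⟨θ, c, hc, hint, hθ⟩ := χ.exists_bump hd
  have hK : eLpNorm (𝓕 θ : 𝓢(RSpace d, ℂ)) p volume ≠ ⊤ :=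
    ((𝓕 θ : 𝓢(RSpace d, ℂ)).memLp p volume).2.ne
  refine ⟨(eLpNorm (𝓕 θ : 𝓢(RSpace d, ℂ)) p volume).toNNReal, c, hc, fun M a ha0 ha => ?_⟩
  obtain ⟨T, hT⟩ := exists_lacunary_extension (fun ξ h => (hθ ξ h).2.1) M ha0 ha
  set F : 𝓢'(RSpace d, ℂ) :=
    𝓕⁻ (ContinuousLinearMap.toPointwiseConvergenceCLM _ _ _ _ T : 𝓢'(RSpace d, ℂ)) with hF
  have hv : ∀ m v, SchwartzMap.smulLeftCLM ℂ (χ.dyadicSymbol m) v ∈ vanishingNearZero d := by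
    intro m v
    filter_upwards [χ.dyadicSymbol_eventually_zero m] with ξ hξ
    rw [SchwartzMap.smulLeftCLM_apply_apply (χ.dyadicSymbol_hasTemperateGrowth m), hξ, zero_smul]
  -- The choice of the extension `T` is invisible to the blocks: their symbols vanish near the
  -- origin, where `T` is given by the series.
  have hblock : ∀ m u, χ.block m ((polynomials d).mkQ F) u =
      ∑' j, (a j : ℂ) * if m = -(j : ℤ) then dilatedPairing θ j (𝓕⁻ u) else 0 := by
    intro m u
    rw [block_mk_apply, hF, FourierTransform.fourier_fourierInv_eq]
    change T _ = _
    rw [hT _ (hv _ _)]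
    simp only [χ.dilatedPairing_smulLeft hθ]
  have hblock' : ∀ (j : ℕ) u, χ.block (-(j : ℤ)) ((polynomials d).mkQ F) u =
      a j * dilatedPairing θ j (𝓕⁻ u) := by
    intro j u
    rw [hblock, tsum_eq_single j]
    · simp
    · intro k hk
      rw [if_neg (by omega), mul_zero]
  refine ⟨(polynomials d).mkQ F, fun j => ?_, fun m hm => ?_, fun j => ?_⟩
  · rw [pairing, hblock', FourierTransform.fourierInv_fourier_eq, neg_neg,
      χ.dilatedPairing_lowSymbol (fun ξ h => (hθ ξ h).2.1), hint]
    push_cast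
    ring
  · ext u
    rw [hblock]
    simp only [show ∀ j : ℕ, m ≠ -(j : ℤ) by omega, if_false, mul_zero, tsum_zero]
    rfl
  · have h1 : χ.block (-(j : ℤ)) ((polynomials d).mkQ F) =
        SchwartzMap.toTemperedDistributionCLM (RSpace d) ℂ volume
          (((a j : ℂ) * ((2 : ℝ) ^ j) ^ d : ℂ) •
            𝓕⁻ (SchwartzMap.dilate (twoUnit ^ (j : ℤ)) θ)) := by
      ext u
      rw [hblock', dilatedPairing_fourierInv, mul_smul, map_smul _ (a j : ℂ), smul_apply,
        smul_eq_mul]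
    rw [h1]
    refine (distLpNorm_toTemperedDistributionCLM_le _).trans (le_of_eq ?_)
    have h2 : ∀ (z : ℂ) (g : 𝓢(RSpace d, ℂ)), ((z • g : 𝓢(RSpace d, ℂ)) : RSpace d → ℂ) =
      z • (g : RSpace d → ℂ) := fun z g => rfl
    rw [h2, eLpNorm_const_smul, SchwartzMap.eLpNorm_fourierInv, SchwartzMap.eLpNorm_fourier_dilate _
      (by rw [val_twoUnit_zpow]; positivity), val_twoUnit_zpow, ENNReal.coe_toNNReal hK]
    have h3 : ‖(a j : ℂ) * ((2 : ℝ) ^ j) ^ d‖ₑ = ENNReal.ofReal (a j * ((2 : ℝ) ^ j) ^ d) := by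
      rw [← ofReal_norm, norm_mul, Complex.norm_real, Real.norm_of_nonneg (ha0 j)]
      simp
    have h4 : (2 : ℝ≥0∞) ^ ((j : ℝ) * (d / p.toReal)) =
        ENNReal.ofReal ((2 : ℝ) ^ ((j : ℝ) * (d / p.toReal))) := by
      rw [← ENNReal.ofReal_rpow_of_pos two_pos, ENNReal.ofReal_ofNat]
    have h5 : ((2 : ℝ) ^ j) ^ d * ((2 : ℝ) ^ (j : ℤ)) ^ (d / p.toReal - d : ℝ) =
        (2 : ℝ) ^ ((j : ℝ) * (d / p.toReal)) := by
      rw [zpow_natCast, ← Real.rpow_natCast _ d, ← Real.rpow_add (by positivity),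
        ← Real.rpow_natCast, ← Real.rpow_mul zero_le_two]
      ring_nf
    rw [h3, h4, ← mul_assoc, ← ENNReal.ofReal_mul (mul_nonneg (ha0 j) (by positivity)), mul_assoc,
      h5, ENNReal.ofReal_mul (ha0 j)]
    ring

end LowFreqCutoff


/-! ### Tails of sequences in `ℓʳ(ℤ)` -/

section Tails

/-- Dominated convergence for the counting measure, which needs r finite. -/
theorem tendsto_eLpNorm_indicator_of_ne_top {c : ℤ → ℝ≥0∞} {r : ℝ≥0∞} (hr0 : r ≠ 0) (hr : r ≠ ⊤)
    (hc : eLpNorm c r Measure.count ≠ ⊤) :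
    Tendsto (fun n : ℕ => eLpNorm ({m : ℤ | m < 3 - n}.indicator c) r Measure.count)
      atTop (𝓝 0) := by
  have hr' : 0 < r.toReal := ENNReal.toReal_pos hr0 hr
  simp only [eLpNorm_eq_lintegral_rpow_enorm_toReal hr0 hr, enorm_eq_self] at hc ⊢
  have h1 : Tendsto (fun n : ℕ => ∫⁻ m : ℤ, ({m : ℤ | m < 3 - n}.indicator c m) ^ r.toReal
      ∂Measure.count) atTop (𝓝 (∫⁻ _ : ℤ, 0 ∂Measure.count)) := by
    refine tendsto_lintegral_of_dominated_convergence (fun m => c m ^ r.toReal)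
      (fun n => measurable_of_countable _) (fun n => Eventually.of_forall fun m => ?_) ?_
      (Eventually.of_forall fun m => ?_)
    · exact ENNReal.rpow_le_rpow (Set.indicator_le_self _ _ _) hr'.le
    · intro h
      apply hc
      rw [h]
      exact ENNReal.top_rpow_of_pos (by positivity)
    · refine tendsto_const_nhds.congr' ?_
      filter_upwards [eventually_ge_atTop (3 - m).toNat] with n hn
      rw [Set.indicator_of_notMem, ENNReal.zero_rpow_of_pos hr']
      simp only [Set.mem_ofPred_eq, not_lt]
      omega
  rw [lintegral_zero] at h1
  have h2 := (ENNReal.continuous_rpow_const (y := 1 / r.toReal)).tendsto 0 |>.comp h1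
  rwa [ENNReal.zero_rpow_of_pos (by positivity)] at h2

variable {c : ℤ → ℝ≥0∞} {K : ℝ≥0} {b : ℕ → ℝ}

theorem eLpNorm_top_indicator_le (hpos : ∀ m : ℤ, 0 < m → c m = 0)
    (hle : ∀ j : ℕ, c (-(j : ℤ)) ≤ K * ENNReal.ofReal (b j)) {N : ℤ} {B : ℝ}
    (hB : ∀ j : ℕ, -(j : ℤ) < N → b j ≤ B) :
    eLpNorm ({m : ℤ | m < N}.indicator c) ⊤ Measure.count ≤ K * ENNReal.ofReal B := by
  rw [eLpNorm_exponent_top]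
  refine essSup_le_of_ae_le _ (Eventually.of_forall fun m => ?_)
  change {m : ℤ | m < N}.indicator c m ≤ K * ENNReal.ofReal B
  by_cases hm : m < N
  · rw [Set.indicator_of_mem (by exact hm)]
    rcases lt_or_ge 0 m with h | h
    · rw [hpos m h]; exact zero_le
    · obtain ⟨j, rfl⟩ : ∃ j : ℕ, m = -(j : ℤ) := ⟨m.natAbs, by omega⟩
      refine (hle j).trans ?_
      gcongr
      exact hB j hm
  · rw [Set.indicator_of_notMem (by exact hm)]
    exact zero_le

theorem eLpNorm_count_ne_top {r : ℝ≥0∞} (hr0 : r ≠ 0) (hpos : ∀ m : ℤ, 0 < m → c m = 0)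
    (hle : ∀ j : ℕ, c (-(j : ℤ)) ≤ K * ENNReal.ofReal (b j)) (hb0 : ∀ j, 0 ≤ b j)
    (hb1 : ∀ j, b j ≤ 1) (hsum : r ≠ ⊤ → Summable fun j => b j ^ r.toReal) :
    eLpNorm c r Measure.count ≠ ⊤ := by
  rcases eq_or_ne r ⊤ with rfl | hr
  · rw [eLpNorm_exponent_top]
    refine ne_top_of_le_ne_top (ENNReal.mul_ne_top (ENNReal.coe_ne_top (r := K))
      (ENNReal.ofReal_ne_top (r := 1))) ?_
    refine essSup_le_of_ae_le _ (Eventually.of_forall fun m => ?_)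
    change c m ≤ K * ENNReal.ofReal 1
    rcases lt_or_ge 0 m with h | h
    · rw [hpos m h]; exact zero_le
    · obtain ⟨j, rfl⟩ : ∃ j : ℕ, m = -(j : ℤ) := ⟨m.natAbs, by omega⟩
      refine (hle j).trans ?_
      gcongr
      exact hb1 j
  · have hr' : 0 < r.toReal := ENNReal.toReal_pos hr0 hr
    rw [eLpNorm_eq_lintegral_rpow_enorm_toReal hr0 hr, lintegral_count]
    simp only [enorm_eq_self]
    refine ENNReal.rpow_ne_top_of_nonneg (by positivity) ?_
    have hinj : Function.Injective fun j : ℕ => -(j : ℤ) := fun i j h => by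
      simpa using h
    rw [← hinj.tsum_eq]
    · have h1 : ∀ j : ℕ, c (-(j : ℤ)) ^ r.toReal ≤
          (K : ℝ≥0∞) ^ r.toReal * ENNReal.ofReal (b j ^ r.toReal) := by
        intro j
        rw [← ENNReal.ofReal_rpow_of_nonneg (hb0 j) hr'.le, ← ENNReal.mul_rpow_of_nonneg _ _ hr'.le]
        exact ENNReal.rpow_le_rpow (hle j) hr'.le
      refine ne_top_of_le_ne_top ?_ (ENNReal.tsum_le_tsum h1)
      rw [ENNReal.tsum_mul_left]
      exact ENNReal.mul_ne_top (ENNReal.rpow_ne_top_of_nonneg hr'.le ENNReal.coe_ne_top)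
        (hsum hr).tsum_ofReal_ne_top
    · intro m hm
      rcases lt_or_ge 0 m with h | h
      · simp [hpos m h, hr'] at hm
      · exact ⟨m.natAbs, by change -(m.natAbs : ℤ) = m; omega⟩

/-- For r = ∞ a finite norm does not make the tails vanish; the monotone decay of b to 0 does. -/
theorem tendsto_eLpNorm_indicator {r : ℝ≥0∞} (hr0 : r ≠ 0) (hpos : ∀ m : ℤ, 0 < m → c m = 0)
    (hle : ∀ j : ℕ, c (-(j : ℤ)) ≤ K * ENNReal.ofReal (b j)) (hb : Antitone b)
    (hb' : Tendsto b atTop (𝓝 0)) (hc : eLpNorm c r Measure.count ≠ ⊤) :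
    Tendsto (fun n : ℕ => eLpNorm ({m : ℤ | m < 3 - n}.indicator c) r Measure.count)
      atTop (𝓝 0) := by
  rcases eq_or_ne r ⊤ with rfl | hr
  -- The indices -j < 3 - n satisfy j ≥ n - 3, with truncated subtraction, so b(n - 3) bounds the
  -- tail by monotonicity.
  · have h1 : Tendsto (fun n : ℕ => (K : ℝ≥0∞) * ENNReal.ofReal (b (n - 3))) atTop (𝓝 0) := by
      have h2 := ENNReal.tendsto_ofReal (hb'.comp (tendsto_sub_atTop_nat 3))
      have h3 := ENNReal.Tendsto.const_mul (a := (K : ℝ≥0∞)) h2 (Or.inr ENNReal.coe_ne_top)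
      simpa using h3
    refine tendsto_of_tendsto_of_tendsto_of_le_of_le tendsto_const_nhds h1
      (fun _ => zero_le) fun n => ?_
    exact eLpNorm_top_indicator_le hpos hle fun j hj => hb (by omega)
  · exact tendsto_eLpNorm_indicator_of_ne_top hr0 hr hc

end Tails

/-! ### The main theorem -/

namespace BesovSpace

variable {d : ℕ} {χ : LowFreqCutoff d} {s : ℝ} {p r : ℝ≥0∞} [Fact (1 ≤ p)] [Fact (1 ≤ r)]

/-- A class of the Besov space whose low frequencies have small norm is a limit of classes of
homogeneous distributions. -/
theorem mem_closure_homogeneousPart (x : BesovSpace χ s p r)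
    (h : Tendsto (fun n : ℕ => eLpNorm ({m : ℤ | m < 3 - n}.indicator fun m : ℤ =>
      (2 : ℝ≥0∞) ^ ((m : ℝ) * s) * distLpNorm p (χ.block m (incl χ s p r x))) r Measure.count)
      atTop (𝓝 0)) :
    x ∈ closure (homogeneousPart χ s p r : Set (BesovSpace χ s p r)) := by
  obtain ⟨C, hC⟩ := χ.exists_distLpNorm_block_low_le p
  obtain ⟨f, hf⟩ := (polynomials d).mkQ_surjective (incl χ s p r x)
  set c : ℤ → ℝ≥0∞ := fun m =>
    (2 : ℝ≥0∞) ^ ((m : ℝ) * s) * distLpNorm p (χ.block m (incl χ s p r x)) with hc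
  have hbound : ∀ n : ℕ, besovENorm χ s p r ((polynomials d).mkQ (χ.low n f)) ≤
      C * eLpNorm ({m : ℤ | m < 3 - n}.indicator c) r Measure.count := by
    intro n
    refine eLpNorm_le_mul_eLpNorm_of_ae_le_mul' (Eventually.of_forall fun m => ?_) r
    rw [enorm_eq_self, enorm_eq_self]
    by_cases hm : m < 3 - n
    · rw [Set.indicator_of_mem (by exact hm), hc]
      calc _ ≤ (2 : ℝ≥0∞) ^ ((m : ℝ) * s) *
            (C * distLpNorm p (χ.block m ((polynomials d).mkQ f))) := by
            gcongr
            exact hC m n f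
        _ = _ := by rw [hf]; ring
    · rw [χ.block_low_eq_zero (by omega), distLpNorm_zero, mul_zero]
      exact zero_le
  have hcfin : eLpNorm c r Measure.count ≠ ⊤ := besovENorm_ne_top χ s p r x
  have hfin : ∀ n : ℕ, eLpNorm ({m : ℤ | m < 3 - n}.indicator c) r Measure.count ≠ ⊤ := fun n =>
    ne_top_of_le_ne_top hcfin (eLpNorm_indicator_le _)
  let z : ℕ → BesovSpace χ s p r := fun n => ⟨(polynomials d).mkQ (χ.low n f),
    (hbound n).trans_lt (ENNReal.mul_lt_top ENNReal.coe_lt_top (hfin n).lt_top)⟩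
  have hz : Tendsto z atTop (𝓝 0) := by
    rw [tendsto_zero_iff_norm_tendsto_zero]
    have h1 : Tendsto (fun n : ℕ => (C * eLpNorm ({m : ℤ | m < 3 - n}.indicator c) r
        Measure.count).toReal) atTop (𝓝 0) := by
      have h2 := ENNReal.Tendsto.const_mul (a := (C : ℝ≥0∞)) h (Or.inr ENNReal.coe_ne_top)
      rw [mul_zero] at h2
      exact (ENNReal.tendsto_toReal ENNReal.zero_ne_top).comp h2
    exact squeeze_zero (fun n => norm_nonneg _) (fun n => ENNReal.toReal_mono
      (ENNReal.mul_ne_top ENNReal.coe_ne_top (hfin n)) (hbound n)) h1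
  have hxz : Tendsto (fun n => x - z n) atTop (𝓝 x) := by
    simpa using hz.const_sub x
  -- The approximants are the classes of f - χ(2^n D) f, which are homogeneous whatever the
  -- representative f.
  refine mem_closure_of_tendsto hxz (Eventually.of_forall fun n => ?_)
  refine ⟨f - χ.low n f, χ.sub_low_mem_homogeneousDist n f, ?_⟩
  rw [map_sub, map_sub, hf]
  rfl

theorem notMem_homogeneousPart {x : BesovSpace χ s p r} {e : ℕ → ℝ}
    (he : ∀ j : ℕ, e j ≤ (χ.pairing (-(j : ℤ)) (incl χ s p r x)).re)
    (hsum : Tendsto (fun n => ∑ j ∈ Finset.range n, e j) atTop atTop) :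
    x ∉ homogeneousPart χ s p r := by
  rintro ⟨f, hf, hfx⟩
  have h1 := (Complex.continuous_re.tendsto _).comp (χ.tendsto_sum_pairing hf)
  refine not_tendsto_nhds_of_tendsto_atTop ?_ _ h1
  refine tendsto_atTop_mono (fun n => ?_) hsum
  rw [Function.comp_apply, Complex.re_sum]
  refine Finset.sum_le_sum fun j _ => ?_
  rw [hfx]
  exact he j

/-- The sole place where the critical case s = d/p needs r > 1. If δ > 0, a_j = 1 works by geometric
decay; if δ = 0, the harmonic sequence is in `ℓʳ` for r > 1 but not summable. -/
theorem exists_coeff {δ : ℝ} (h : 0 < δ ∨ δ = 0 ∧ 1 < r) :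
    ∃ a : ℕ → ℝ, (∀ j, 0 ≤ a j) ∧ (∀ j, a j ≤ 1) ∧
      Tendsto (fun n => ∑ j ∈ Finset.range n, a j) atTop atTop ∧
      Antitone (fun j : ℕ => a j * (2 : ℝ) ^ (-(j * δ))) ∧
      Tendsto (fun j : ℕ => a j * (2 : ℝ) ^ (-(j * δ))) atTop (𝓝 0) ∧
      (r ≠ ⊤ → Summable fun j : ℕ => (a j * (2 : ℝ) ^ (-(j * δ))) ^ r.toReal) := by
  rcases h with h | ⟨rfl, hr1⟩
  · have hq : (2 : ℝ) ^ (-δ) < 1 := Real.rpow_lt_one_of_one_lt_of_neg one_lt_two (by linarith)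
    have hq0 : (0 : ℝ) < 2 ^ (-δ) := by positivity
    have he : ∀ j : ℕ, (1 : ℝ) * (2 : ℝ) ^ (-(j * δ)) = ((2 : ℝ) ^ (-δ)) ^ j := by
      intro j
      rw [one_mul, ← Real.rpow_mul_natCast zero_le_two]
      ring_nf
    refine ⟨fun _ => 1, fun _ => zero_le_one, fun _ => le_rfl, ?_, ?_, ?_, fun hr => ?_⟩
    · simpa using tendsto_natCast_atTop_atTop
    · simp only [he]
      exact pow_right_anti₀ hq0.le hq.le
    · simp only [he]
      exact tendsto_pow_atTop_nhds_zero_of_lt_one hq0.le hq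
    · have hr' : 0 < r.toReal :=
        ENNReal.toReal_pos (zero_lt_one.trans_le (Fact.out : 1 ≤ r)).ne' hr
      simp only [he]
      have h2 : ∀ j : ℕ, (((2 : ℝ) ^ (-δ)) ^ j) ^ r.toReal = (((2 : ℝ) ^ (-δ)) ^ r.toReal) ^ j := by
        intro j
        rw [← Real.rpow_natCast_mul hq0.le, ← Real.rpow_mul_natCast hq0.le, mul_comm]
      simp only [h2]
      exact summable_geometric_of_lt_one (by positivity) (Real.rpow_lt_one hq0.le hq hr')
  · simp only [mul_zero, neg_zero, Real.rpow_zero, mul_one]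
    refine ⟨fun j => 1 / ((j : ℝ) + 1), fun j => by positivity, fun j => ?_,
      Real.tendsto_sum_range_one_div_nat_succ_atTop, fun i j hij => ?_,
      tendsto_one_div_add_atTop_nhds_zero_nat, fun hr => ?_⟩
    · rw [div_le_one (by positivity)]
      linarith [j.cast_nonneg (α := ℝ)]
    · exact one_div_le_one_div_of_le (by positivity) (by gcongr)
    · have hr' : 1 < r.toReal := by
        rw [← ENNReal.toReal_one]
        exact (ENNReal.toReal_lt_toReal ENNReal.one_ne_top hr).2 hr1
      have h3 := (summable_nat_add_iff 1).2 (Real.summable_one_div_nat_rpow.2 hr')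
      refine h3.congr fun j => ?_
      rw [Real.div_rpow zero_le_one (by positivity), Real.one_rpow]
      push_cast
      rfl

theorem two_rpow_mul_ofReal (y z : ℝ) :
    (2 : ℝ≥0∞) ^ y * ENNReal.ofReal z = ENNReal.ofReal (z * 2 ^ y) := by
  rw [mul_comm z, ENNReal.ofReal_mul (by positivity), ← ENNReal.ofReal_rpow_of_pos two_pos,
    ENNReal.ofReal_ofNat]

theorem two_rpow_mul_le {j : ℕ} {K : ℝ≥0} {A : ℝ≥0∞} {t z : ℝ}
    (h : A ≤ K * (2 : ℝ≥0∞) ^ ((j : ℝ) * t) * ENNReal.ofReal z) :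
    (2 : ℝ≥0∞) ^ (((-(j : ℤ) : ℤ) : ℝ) * s) * A ≤
      K * ENNReal.ofReal (z * (2 : ℝ) ^ (-(j * (s - t)))) := by
  rw [← two_rpow_mul_ofReal]
  calc _ ≤ (2 : ℝ≥0∞) ^ (((-(j : ℤ) : ℤ) : ℝ) * s) *
        (K * (2 : ℝ≥0∞) ^ ((j : ℝ) * t) * ENNReal.ofReal z) := by gcongr
    _ = K * (((2 : ℝ≥0∞) ^ (((-(j : ℤ) : ℤ) : ℝ) * s) * (2 : ℝ≥0∞) ^ ((j : ℝ) * t)) *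
        ENNReal.ofReal z) := by ring
    _ = _ := by
      rw [← ENNReal.rpow_add _ _ two_ne_zero ENNReal.ofNat_ne_top]
      congr 3
      push_cast
      ring

theorem not_isClosed_homogeneousPart (hd : 1 ≤ d)
    (h : 0 < s - d / p.toReal ∨ s - d / p.toReal = 0 ∧ 1 < r) :
    ¬ IsClosed (homogeneousPart χ s p r : Set (BesovSpace χ s p r)) := by
  obtain ⟨a, ha0, ha1, hsum, hanti, hlim, hsummable⟩ := exists_coeff h
  obtain ⟨K, c, hc, hK⟩ := χ.exists_lacunary hd p
  -- The coefficients are at most 1, so growth order M = 0 suffices.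
  obtain ⟨x, hx1, hx2, hx3⟩ := hK 0 a ha0 (by simpa using ha1)
  have hr0 : r ≠ 0 := (zero_lt_one.trans_le (Fact.out : 1 ≤ r)).ne'
  have hpos : ∀ m : ℤ, 0 < m →
      (2 : ℝ≥0∞) ^ ((m : ℝ) * s) * distLpNorm p (χ.block m x) = 0 := fun m hm => by
    rw [hx2 m hm, distLpNorm_zero, mul_zero]
  have hle := fun j : ℕ => two_rpow_mul_le (s := s) (hx3 j)
  have hfin := eLpNorm_count_ne_top (r := r)
    (c := fun m : ℤ => (2 : ℝ≥0∞) ^ ((m : ℝ) * s) * distLpNorm p (χ.block m x)) hr0 hpos hle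
    (fun j => mul_nonneg (ha0 j) (by positivity))
    (fun j => (hanti (Nat.zero_le j)).trans (by simpa using ha1 0)) hsummable
  have htail := tendsto_eLpNorm_indicator (r := r)
    (c := fun m : ℤ => (2 : ℝ≥0∞) ^ ((m : ℝ) * s) * distLpNorm p (χ.block m x)) hr0 hpos hle
    hanti hlim hfin
  let X : BesovSpace χ s p r := ⟨x, hfin.lt_top⟩
  intro hcl
  have h1 : X ∈ homogeneousPart χ s p r := by
    have h2 := mem_closure_homogeneousPart X htail
    rwa [hcl.closure_eq] at h2
  refine notMem_homogeneousPart (x := X) (e := fun j => c * a j) (fun j => ?_) ?_ h1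
  · change c * a j ≤ (χ.pairing (-(j : ℤ)) x).re
    rw [hx1 j, Complex.ofReal_re]
  · simp only [← Finset.mul_sum]
    exact hsum.const_mul_atTop hc

theorem dense_homogeneousPart (hr : r ≠ ⊤) :
    Dense (homogeneousPart χ s p r : Set (BesovSpace χ s p r)) := fun x =>
  mem_closure_homogeneousPart x (tendsto_eLpNorm_indicator_of_ne_top
    (zero_lt_one.trans_le (Fact.out : 1 ≤ r)).ne' hr (besovENorm_ne_top χ s p r x))

theorem block_le_norm (x : BesovSpace χ s p ⊤) (m : ℤ) :
    (2 : ℝ≥0∞) ^ ((m : ℝ) * s) * distLpNorm p (χ.block m (incl χ s p ⊤ x)) ≤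
      ENNReal.ofReal ‖x‖ := by
  change _ ≤ ENNReal.ofReal (besovENorm χ s p ⊤ (incl χ s p ⊤ x)).toReal
  rw [ENNReal.ofReal_toReal (besovENorm_ne_top χ s p ⊤ x), besovENorm, eLpNorm_exponent_top]
  have h1 := enorm_ae_le_eLpNormEssSup (fun m : ℤ => (2 : ℝ≥0∞) ^ ((m : ℝ) * s) *
    distLpNorm p (χ.block m (incl χ s p ⊤ x))) Measure.count
  rw [Measure.ae_count_iff] at h1
  exact h1 m

/-- With a_j = 2^(jδ) the weighted blocks stay bounded, while the pairings c 2^(jδ) have exactly the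
size of the Bernstein bound. A perturbation of small norm removes at most half of each pairing. -/
theorem not_dense_homogeneousPart_top (hd : 1 ≤ d) (h : 0 ≤ s - d / p.toReal) :
    ¬ Dense (homogeneousPart χ s p ⊤ : Set (BesovSpace χ s p ⊤)) := by
  set δ := s - d / p.toReal with hδ
  obtain ⟨K, c, hc, hK⟩ := χ.exists_lacunary hd p
  obtain ⟨C, hC⟩ := χ.exists_enorm_pairing_le p
  obtain ⟨x, hx1, hx2, hx3⟩ := hK ⌈δ⌉₊ (fun j => (2 : ℝ) ^ (j * δ)) (fun j => by positivity)
    (fun j => by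
      rw [← Real.rpow_natCast 2, ← Real.rpow_mul_natCast zero_le_two]
      refine Real.rpow_le_rpow_of_exponent_le one_le_two ?_
      rw [mul_comm]
      gcongr
      exact Nat.le_ceil δ)
  have hpos : ∀ m : ℤ, 0 < m →
      (2 : ℝ≥0∞) ^ ((m : ℝ) * s) * distLpNorm p (χ.block m x) = 0 := fun m hm => by
    rw [hx2 m hm, distLpNorm_zero, mul_zero]
  have hfin := eLpNorm_count_ne_top (r := ⊤) (b := fun _ => 1)
    (c := fun m : ℤ => (2 : ℝ≥0∞) ^ ((m : ℝ) * s) * distLpNorm p (χ.block m x)) ENNReal.top_ne_zero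
    hpos (fun j : ℕ => (two_rpow_mul_le (s := s) (hx3 j)).trans (le_of_eq (by
      rw [← hδ, ← Real.rpow_add two_pos, add_neg_cancel, Real.rpow_zero])))
    (fun j => zero_le_one) (fun j => le_rfl) (fun h => absurd rfl h)
  let X : BesovSpace χ s p ⊤ := ⟨x, hfin.lt_top⟩
  intro hdense
  -- Chosen so that C ε ≤ c/2; the added 1 covers C = 0.
  have hε : 0 < c / (2 * (C + 1)) := by positivity
  obtain ⟨y, hy, hxy⟩ := hdense.exists_dist_lt X hε
  rw [dist_eq_norm] at hxy
  refine notMem_homogeneousPart (x := y) (e := fun _ => c / 2) (fun j => ?_) ?_ hy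
  · have h1 := hC (-(j : ℤ)) (incl χ s p ⊤ (X - y))
    have h2 := block_le_norm (X - y) (-(j : ℤ))
    have h3 : ‖χ.pairing (-(j : ℤ)) (incl χ s p ⊤ (X - y))‖ₑ ≤
        ENNReal.ofReal (C * (‖X - y‖ * (2 : ℝ) ^ (j * δ))) := by
      rw [ENNReal.ofReal_mul C.coe_nonneg, ENNReal.ofReal_coe_nnreal, ← two_rpow_mul_ofReal]
      refine h1.trans ?_
      have h4 : (2 : ℝ≥0∞) ^ (((-(j : ℤ) : ℤ) : ℝ) * (d / p.toReal)) =
          (2 : ℝ≥0∞) ^ ((j : ℝ) * δ) * (2 : ℝ≥0∞) ^ (((-(j : ℤ) : ℤ) : ℝ) * s) := by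
        rw [← ENNReal.rpow_add _ _ two_ne_zero ENNReal.ofNat_ne_top]
        congr 1
        rw [hδ]
        push_cast
        ring
      rw [h4, mul_assoc, mul_assoc]
      gcongr
    have h5 : ‖χ.pairing (-(j : ℤ)) (incl χ s p ⊤ (X - y))‖ ≤
        C * (‖X - y‖ * (2 : ℝ) ^ (j * δ)) := by
      rw [← ofReal_norm] at h3
      exact (ENNReal.ofReal_le_ofReal_iff (by positivity)).1 h3
    rw [map_sub, LowFreqCutoff.pairing_sub] at h5
    have h6 : χ.pairing (-(j : ℤ)) (incl χ s p ⊤ X) = (c * (2 : ℝ) ^ (j * δ) : ℝ) := hx1 j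
    have h7 := (Complex.re_le_norm _).trans h5
    rw [Complex.sub_re, h6, Complex.ofReal_re] at h7
    have h8 : 1 ≤ (2 : ℝ) ^ (j * δ) := Real.one_le_rpow one_le_two (by positivity)
    have h9 : C * ‖X - y‖ ≤ c / 2 := by
      calc C * ‖X - y‖ ≤ (C + 1) * (c / (2 * (C + 1))) := by
            gcongr
            linarith
        _ = c / 2 := by field_simp
    -- The real part of the pairing of y is at least c 2^(jδ) - (c/2) 2^(jδ), hence at least c/2
    -- because 2^(jδ) ≥ 1.
    nlinarith
  · simp only [Finset.sum_const, Finset.card_range, nsmul_eq_mul]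
    exact tendsto_natCast_atTop_atTop.atTop_mul_const (by positivity)

end BesovSpace

end

theorem theoremt {d : ℕ} (hd : 1 ≤ d) (χ : LowFreqCutoff d) (s : ℝ) (p r : ℝ≥0∞)
    [Fact (1 ≤ p)] [Fact (1 ≤ r)]
    (hsupercritical : ((d : ℝ≥0∞) / p).toReal < s ∨ s = ((d : ℝ≥0∞) / p).toReal ∧ 1 < r) :
    ¬ IsClosed (BesovSpace.homogeneousPart χ s p r : Set (BesovSpace χ s p r)) ∧
    (Dense (BesovSpace.homogeneousPart χ s p r : Set (BesovSpace χ s p r)) ↔ r < ⊤) := by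
  -- At p = ∞ the two readings of d/p agree: d/∞ = 0 in the extended reals, and d/0 = 0 by
  -- convention in ℝ.
  rw [ENNReal.toReal_div, ENNReal.toReal_natCast] at hsupercritical
  refine ⟨BesovSpace.not_isClosed_homogeneousPart hd ?_, fun h => ?_,
    fun h => BesovSpace.dense_homogeneousPart h.ne⟩
  · rcases hsupercritical with h | ⟨h, hr⟩
    · exact Or.inl (sub_pos.2 h)
    · exact Or.inr ⟨sub_eq_zero.2 h, hr⟩
  · by_contra hr
    obtain rfl := not_lt_top_iff.1 hr
    refine BesovSpace.not_dense_homogeneousPart_top hd ?_ h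
    rcases hsupercritical with h | ⟨h, -⟩
    · exact (sub_pos.2 h).le
    · exact (sub_eq_zero.2 h).ge
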